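/- \textbf{Conventions.} Indices are the positive integers. A coefficient function is a map $\epsilon:\mathbb N\to\mathbb N\cup\{0\}$, $\epsilon=(\epsilon_1,\epsilon_2,\dots)$; $\beta^i$ is the one with $\beta^i_i=1$ and $\beta^i_k=0$ for $k\ne i$. The order of $\epsilon\neq0$ is the smallest $n$ with $\epsilon_n\ne0$. For $J\subseteq\mathbb N$, $\epsilon|_J$ agrees with $\epsilon$ on $J$ and vanishes elsewhere. Coefficient functions are ordered lexicographically: $\epsilon<\epsilon'$ if for some $k$ we have $\epsilon_j=\epsilon'_j$ for $j<k$ and $\epsilon_k<\epsilon'_k$; in a set $S$ of coefficient functions, the immediate successor (predecessor) of $\delta$ is the smallest (largest) member of $S$ that is greater (less) than $\delta$. For a real sequence $Q=(Q_1,Q_2,\dots)$ put $\sum\epsilon Q=\sum_{k\ge1}\epsilon_kQ_k$. Decreasing means strictly decreasing. For a set $\mathcal E$ of coefficient functions let $\mathcal E^M=\{\epsilon|_{[1,M]}:\epsilon\in\mathcal E\}$. A set $\mathcal E$ containing $0$ and all $\beta^i$ is called \emph{Zeckendorf for $(0,1)$} if: (i) for all $M\ge 1$, every $\mu\in\mathcal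 E^M$ has only finitely many smaller elements in $\mathcal E^M$; (ii) for each $n\ge1$ there is a unique coefficient function $\bar\beta^n$ of order $n$ with infinite support, called the maximal coefficient function of order $n$, such that for all $M\ge n$, $\bar\beta^n|_{[1,M]}$ is the immediate predecessor of $\beta^{n-1}|_{[1,M]}$ in $\mathcal E^M$ if $n\ge2$, and the largest element of $\mathcal E^M$ if $n=1$; (iii) for all $M\ge1$ and $\mu\in\mathcal E^M$ with $\mu<\bar\beta^1|_{[1,M]}$, if the immediate successor $\tilde\mu$ of $\mu$ in $\mathcal E^M$ is not $\mu+\beta^M$, then there is $1\le n<M$ with $\bar\beta^{n+1}_k=\mu_k$ for $n<k\le M$ and $\tilde\mu=\mu|_{[1,n]}+\beta^n$; (iv) a coefficient function $\epsilon$ belongs to $\mathcal E$ if and only if for infinitely many $M\ge1$ we have $\epsilon|_{[1,M]}\in\mathcal E^M$ and the immediate successor of $\epsilon|_{[1,M]}$ in $\mathcal E^M$ is $(\epsilon+\beta^M)|_{[1,M]}$. A sequence $Q$ in $(0,1)$ is a \emph{fundamental sequence for $(0,1)$ under $\mathcal E$} if the sums $\sum\delta Q$, $\delta\in\mathcal E$,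 converge and have distinct values, and $\{\sum\delta Q:0\ne\delta\in\mathcal E\}=(0,1)$. \textbf{Theorem.} (1) Let $Q$ be a decreasing sequence in $(0,1)$, and put $Q_0=1$. (a) If $Q_n\to0$, then there are coefficient functions $\mu^n$ of order $n$ with infinite support, $n\ge1$, such that $Q_{n-1}=\sum\mu^nQ$ for all $n\ge1$. (b) Let $\mathcal E$ be Zeckendorf for $(0,1)$ with maximal coefficient functions $\bar\beta^n$, $n\ge1$. Then $Q$ is a fundamental sequence for $(0,1)$ under $\mathcal E$ if and only if $Q_{n-1}=\sum\bar\beta^nQ$ for all $n\ge1$. (2) Let $N\ge1$ and let $L=(e_1,\dots,e_N)\ne(1)$ be a list of non-negative integers with $e_1e_N>0$. For $n\ge1$ let $\bar\beta^n=(0,\dots,0,e_1,\dots,e_{N-1},e_N-1,e_1,\dots,e_{N-1},e_N-1,\dots)$, which starts at index $n$ and repeats with period $N$. Let $\mathcal L$ be the collection determined by these, that is, the set of all sums $\sum_{m\ge1}\zeta^m$ for which there are indices $n_m\le i_m$ with $n_1=1$, $n_{m+1}=i_m+1$, such that $\zeta^m_k=\bar\beta^{n_m}_k$ for $n_m\le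 k<i_m$, $0\le\zeta^m_{i_m}<\bar\beta^{n_m}_{i_m}$, and $\zeta^m_k=0$ for $k\notin[n_m,i_m]$. Then the polynomial $e_Nx^N+\cdots+e_1x-1$ has exactly one positive real zero $\omega$, there is a fundamental sequence for $(0,1)$ under $\mathcal L$, and the one and only decreasing one is $Q_k=\omega^k$, $k\ge1$. -/

import Mathlib

/-- Coefficient functions `ε = (ε₁, ε₂, …)`; indices are the positive integers.
The descending lexicographical order is the order of `Lex (ℕ+ → ℕ)`, reached through `toLex`. -/
abbrev Coeff : Type := ℕ+ → ℕ

namespace Coeff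

/-- The basis coefficient function `β^i`. -/
def basis (i : ℕ+) : Coeff := fun k => if k = i then 1 else 0

/-- The restriction of `ε` to the indices `1, …, M`. -/
def res (M : ℕ+) (ε : Coeff) : Coeff := fun k => if k ≤ M then ε k else 0

/-- `ε` is non-zero and `n` is the smallest index with `ε_n ≠ 0`. -/
def HasOrder (ε : Coeff) (n : ℕ+) : Prop := IsLeast {k : ℕ+ | ε k ≠ 0} n

/-- `ε` does not have a finite support. -/
def InfSupport (ε : Coeff) : Prop := {k : ℕ+ | ε k ≠ 0}.Infinite

/-- `ν` is the smallest member of `S` that is greater than `δ`. -/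
def IsImmSucc (S : Set Coeff) (δ ν : Coeff) : Prop :=
  ν ∈ S ∧ toLex δ < toLex ν ∧ ∀ x ∈ S, toLex δ < toLex x → toLex ν ≤ toLex x

/-- `ν` is the largest member of `S` that is less than `δ`. -/
def IsImmPred (S : Set Coeff) (δ ν : Coeff) : Prop :=
  ν ∈ S ∧ toLex ν < toLex δ ∧ ∀ x ∈ S, toLex x < toLex δ → toLex x ≤ toLex ν

/-- The collection `𝓔^M` of the restrictions to `[1, M]` of the members of `𝓔`. -/
def trunc (E : Set Coeff) (M : ℕ+) : Set Coeff := res M '' E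

/-- `b` is a maximal coefficient function of order `n` for `E`: it has order `n` and infinite
support, and, for all `M ≥ n`, its restriction to `[1, M]` is the largest member of `𝓔^M` if
`n = 1`, and the immediate predecessor of (the restriction of) `β^{n-1}` in `𝓔^M` if `n ≥ 2`. -/
structure IsMaximal (E : Set Coeff) (n : ℕ+) (b : Coeff) : Prop where
  order : HasOrder b n
  infinite : InfSupport b
  first : n = 1 → ∀ M : ℕ+, res M b ∈ trunc E M ∧ ∀ x ∈ trunc E M, toLex x ≤ toLex (res M b)
  pred : ∀ m : ℕ+, n = m + 1 → ∀ M : ℕ+, n ≤ M →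
    IsImmPred (trunc E M) (res M (basis m)) (res M b)

/-- Zeckendorf collections of coefficient functions for the open unit interval. -/
structure IsZeckendorf (E : Set Coeff) : Prop where
  zero_mem : (0 : Coeff) ∈ E
  basis_mem : ∀ i : ℕ+, basis i ∈ E
  finite_below : ∀ M : ℕ+, ∀ μ ∈ trunc E M, {x ∈ trunc E M | toLex x < toLex μ}.Finite
  maximal : ∀ n : ℕ+, ∃! b : Coeff, IsMaximal E n b
  succ_form : ∀ b : ℕ+ → Coeff, (∀ n, IsMaximal E n (b n)) →
    ∀ M : ℕ+, ∀ μ ∈ trunc E M, toLex μ < toLex (res M (b 1)) →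
      ∀ ν : Coeff, IsImmSucc (trunc E M) μ ν → ν ≠ μ + basis M →
        ∃ n : ℕ+, n < M ∧ (∀ k : ℕ+, n < k → k ≤ M → b (n + 1) k = μ k) ∧
          ν = res n μ + basis n
  mem_iff : ∀ ε : Coeff, ε ∈ E ↔
    {M : ℕ+ | res M ε ∈ trunc E M ∧
      IsImmSucc (trunc E M) (res M ε) (res M (ε + basis M))}.Infinite

/-- `ζ` is a proper `δ`-block at index `n` with support `[n, i]`. -/
structure IsProperBlock (δ : ℕ+ → Coeff) (n i : ℕ+) (ζ : Coeff) : Prop where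
  le : n ≤ i
  last_lt : ζ i < δ n i
  eq_before : ∀ k : ℕ+, n ≤ k → k < i → ζ k = δ n k
  eq_zero : ∀ k : ℕ+, (k < n ∨ i < k) → ζ k = 0

/-- The collection determined by `δ¹, δ², …`: all sums `∑_{m ≥ 1} ζ^m` of proper `δ`-blocks with
supports `[n_m, i_m]` such that `n_1 = 1` and `n_{m+1} = i_m + 1`. At every index at most one
`ζ^m` is non-zero. -/
def determinedBy (δ : ℕ+ → Coeff) : Set Coeff :=
  {ε | ∃ (ζ : ℕ+ → Coeff) (n i : ℕ+ → ℕ+),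
    n 1 = 1 ∧ (∀ m, n (m + 1) = i m + 1) ∧ (∀ m, IsProperBlock δ (n m) (i m) (ζ m)) ∧
    ∀ k, ε k = ∑ᶠ m, ζ m k}

/-- For the list `(e_1, …, e_N)`, the coefficient functions
`β̄^n = (0, …, 0, e_1, e_2, …, e_{N-1}, e_N - 1, e_1, e_2, …)`, periodic from index `n` on.
Only the values `e 1, …, e N` are used. -/
def listMax (N : ℕ) (e : ℕ → ℕ) (n : ℕ+) : Coeff := fun k =>
  if k < n then 0
  else
    let r := ((k : ℕ) - (n : ℕ)) % N + 1
    if r = N then e N - 1 else e r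

/-- The sequence `Q` prolonged by `Q_0 = 1`. -/
noncomputable def withOne (Q : ℕ+ → ℝ) (k : ℕ) : ℝ := if h : 0 < k then Q ⟨k, h⟩ else 1

/-- The value `∑ ε Q = ∑_{k ≥ 1} ε_k Q_k`. -/
noncomputable def value (Q : ℕ+ → ℝ) (ε : Coeff) : ℝ := ∑' k : ℕ+, (ε k : ℝ) * Q k

/-- The unique `𝓔`-representation property: the sums `∑ δ Q`, `δ ∈ 𝓔`, converge and have
distinct values. -/
def UniqueRep (E : Set Coeff) (Q : ℕ+ → ℝ) : Prop :=
  (∀ δ ∈ E, Summable fun k : ℕ+ => (δ k : ℝ) * Q k) ∧ Set.InjOn (value Q) E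

/-- The set of the values `∑ δ Q` for non-zero `δ ∈ 𝓔`. -/
def valueSet (E : Set Coeff) (Q : ℕ+ → ℝ) : Set ℝ := value Q '' (E \ {0})

/-- `Q` is a fundamental sequence, with terms in `(0, 1)`, for the `𝓔`-subset `Y` of `(0, 1)`. -/
def IsFundamental (E : Set Coeff) (Y : Set ℝ) (Q : ℕ+ → ℝ) : Prop :=
  (∀ k, Q k ∈ Set.Ioo (0 : ℝ) 1) ∧ UniqueRep E Q ∧ valueSet E Q = Y

/-- `Q_{n-1} = ∑ μ^n Q` for all `n ≥ 1`, where `Q_0 = 1`; the series converge. -/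
def FullRecursion (μ : ℕ+ → Coeff) (Q : ℕ+ → ℝ) : Prop :=
  ∀ n : ℕ+, HasSum (fun k : ℕ+ => (μ n k : ℝ) * Q k) (withOne Q ((n : ℕ) - 1))

end Coeff

/-!
The members of `determinedBy b` are the sequences whose digits never exceed those of the current
block maximum and which complete infinitely many blocks (`admissible b`).

If `Q` satisfies the full recursion, add to each partial sum of an admissible series what its
current block may still contribute. This potential starts at `Q 0 = 1` and drops whenever a block
is completed; so the series converge, their values lie below `1` and increase lexicographically,
and the greedy expansion reaches every point of `(0, 1)`. Conversely, let `Q` be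
fundamental. A partial sum of `∑ b n Q` above `Q (n - 1)` would yield a second representation of
`Q (n - 1)`. If the whole sum fell short of `Q (n - 1)`, it would be the value of an admissible
function that vanishes before `n`, but the values of these are strictly smaller than `∑ b n Q`.

A Zeckendorf collection is determined by its maximal functions: immediate successors in `𝓔^M`
increase the last digit by one until a carry occurs, and a carry occurs only at a block maximum,
so by induction on `M` the last digit runs exactly through the values up to the block maximum.

For periodic block maxima the full recursion is a linear recursion for `Q`. Dividing by `ω ^ k`
turns it into the statement that each term is a weighted mean of the following `N` terms, and by a
Harnack inequality the non-negative solutions of this are constant.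
-/

namespace Coeff

variable {b : ℕ+ → Coeff} {Q : ℕ+ → ℝ} {ε η : Coeff} {n m : ℕ+} {a : ℝ}

@[elab_as_elim]
lemma pnat_le_induction {P : ∀ m : ℕ+, n ≤ m → Prop} (base : P n le_rfl)
    (succ : ∀ m (hnm : n ≤ m), P m hnm → P (m + 1) (hnm.trans (PNat.lt_add_right m 1).le))
    (m : ℕ+) (hnm : n ≤ m) : P m hnm := by
  induction m using PNat.recOn with
  | one => obtain rfl := le_antisymm hnm one_le; exact base
  | succ m ih =>
    obtain rfl | hlt := hnm.eq_or_lt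
    · exact base
    · exact succ m (PNat.lt_add_one_iff.1 hlt) (ih _)

lemma HasOrder.eq_zero_of_lt (h : HasOrder ε n) (hm : m < n) : ε m = 0 :=
  not_not.1 fun hne => (h.2 hne).not_gt hm

lemma HasOrder.pos (h : HasOrder ε n) : 0 < ε n := Nat.pos_of_ne_zero h.1

lemma InfSupport.exists_pos_of_le (h : InfSupport ε) (m : ℕ+) : ∃ k, m ≤ k ∧ 0 < ε k := by
  obtain ⟨k, hk, hmk⟩ := Set.Infinite.exists_gt h m
  exact ⟨k, hmk.le, Nat.pos_of_ne_zero hk⟩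

lemma basis_self : basis n n = 1 := if_pos rfl

lemma basis_of_ne (h : m ≠ n) : basis n m = 0 := if_neg h

/-- The term `Q_{n-1}`, where `Q_0 = 1`. -/
noncomputable def prevTerm (Q : ℕ+ → ℝ) (n : ℕ+) : ℝ := withOne Q ((n : ℕ) - 1)

lemma prevTerm_one : prevTerm Q 1 = 1 := by simp [prevTerm, withOne]

lemma prevTerm_add_one : prevTerm Q (n + 1) = Q n := dif_pos n.pos

lemma prevTerm_pos (hQ : ∀ k, 0 < Q k) (n : ℕ+) : 0 < prevTerm Q n := by
  induction n using PNat.recOn with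
  | one => simp [prevTerm_one]
  | succ n => simpa only [prevTerm_add_one] using hQ n

lemma prevTerm_le_one (hQ : ∀ k, Q k ≤ 1) (n : ℕ+) : prevTerm Q n ≤ 1 := by
  induction n using PNat.recOn with
  | one => exact prevTerm_one.le
  | succ n => simpa only [prevTerm_add_one] using hQ n

/-- The part of the sum `∑ ε Q` over the indices less than `m`. -/
noncomputable def prefixSum (Q : ℕ+ → ℝ) (ε : Coeff) (m : ℕ+) : ℝ :=
  ∑ k ∈ Finset.Iio m, (ε k : ℝ) * Q k

lemma prefixSum_one : prefixSum Q ε 1 = 0 := by simp [prefixSum]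

lemma prefixSum_add_one : prefixSum Q ε (m + 1) = prefixSum Q ε m + ε m * Q m := by
  rw [prefixSum, Finset.Iio_add_one_eq_Iic, ← Finset.Iio_insert, Finset.sum_insert (by simp),
    add_comm, prefixSum]

lemma prefixSum_congr (h : ∀ k < m, ε k = η k) : prefixSum Q ε m = prefixSum Q η m :=
  Finset.sum_congr rfl fun k hk => by rw [h k (Finset.mem_Iio.1 hk)]

lemma prefixSum_eq_zero (h : ∀ k < m, ε k = 0) : prefixSum Q ε m = 0 :=
  Finset.sum_eq_zero fun k hk => by simp [h k (Finset.mem_Iio.1 hk)]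

lemma term_nonneg (hQ : ∀ k, 0 ≤ Q k) (k : ℕ+) : 0 ≤ (ε k : ℝ) * Q k :=
  mul_nonneg (Nat.cast_nonneg _) (hQ k)

lemma prefixSum_mono (hQ : ∀ k, 0 ≤ Q k) : Monotone (prefixSum Q ε) := fun _ _ h =>
  Finset.sum_le_sum_of_subset_of_nonneg (Finset.Iio_subset_Iio h) fun k _ _ => term_nonneg hQ k

lemma tendsto_prefixSum (h : HasSum (fun k => (ε k : ℝ) * Q k) a) :
    Filter.Tendsto (prefixSum Q ε) Filter.atTop (nhds a) :=
  h.comp (Filter.tendsto_atTop_finset_of_monotone (fun _ _ => Finset.Iio_subset_Iio)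
    fun k => ⟨k + 1, by simp⟩)

lemma prefixSum_le_of_hasSum (hQ : ∀ k, 0 ≤ Q k) (h : HasSum (fun k => (ε k : ℝ) * Q k) a)
    (m : ℕ+) : prefixSum Q ε m ≤ a :=
  (prefixSum_mono hQ).ge_of_tendsto (tendsto_prefixSum h) m

lemma prefixSum_le_value (hQ : ∀ k, 0 ≤ Q k) (hs : Summable fun k => (ε k : ℝ) * Q k) (m : ℕ+) :
    prefixSum Q ε m ≤ value Q ε :=
  prefixSum_le_of_hasSum hQ hs.hasSum m

lemma summable_of_prefixSum_le (hQ : ∀ k, 0 ≤ Q k) (h : ∀ m, prefixSum Q ε m ≤ a) :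
    Summable fun k => (ε k : ℝ) * Q k := by
  refine summable_of_sum_le (c := a) (fun k => term_nonneg hQ k) fun s => ?_
  obtain ⟨m, hm⟩ := s.bddAbove
  exact (Finset.sum_le_sum_of_subset_of_nonneg
    (fun k hk => Finset.mem_Iio.2 (PNat.lt_add_one_iff.2 (hm hk)))
    fun k _ _ => term_nonneg hQ k).trans (h (m + 1))

lemma value_le_of_prefixSum_le (hQ : ∀ k, 0 ≤ Q k) (h : ∀ m, prefixSum Q ε m ≤ a) :
    value Q ε ≤ a :=
  le_of_tendsto' (tendsto_prefixSum (summable_of_prefixSum_le hQ h).hasSum) h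

lemma prefixSum_lt_value (hQ : ∀ k, 0 < Q k) (hs : Summable fun k => (ε k : ℝ) * Q k)
    (hi : InfSupport ε) (m : ℕ+) : prefixSum Q ε m < value Q ε := by
  obtain ⟨k, hmk, hk⟩ := hi.exists_pos_of_le m
  have hlt : prefixSum Q ε k < prefixSum Q ε (k + 1) := by
    rw [prefixSum_add_one]
    exact lt_add_of_pos_right _ (mul_pos (Nat.cast_pos.2 hk) (hQ k))
  exact (prefixSum_mono (fun k => (hQ k).le) hmk).trans_lt
    (hlt.trans_le (prefixSum_le_value (fun k => (hQ k).le) hs (k + 1)))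

lemma value_zero : value Q 0 = 0 := by simp [value]

lemma value_basis : value Q (basis n) = Q n := by
  rw [value, tsum_eq_single n fun k hk => by simp [basis_of_ne hk]]
  simp [basis_self]

lemma value_nonneg (hQ : ∀ k, 0 ≤ Q k) : 0 ≤ value Q ε := tsum_nonneg (term_nonneg hQ)

lemma value_pos (hQ : ∀ k, 0 < Q k) (hs : Summable fun k => (ε k : ℝ) * Q k) (h : ε ≠ 0) :
    0 < value Q ε := by
  obtain ⟨k, hk⟩ := Function.ne_iff.1 h
  exact hs.tsum_pos (term_nonneg fun k => (hQ k).le) k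
    (mul_pos (Nat.cast_pos.2 (Nat.pos_of_ne_zero hk)) (hQ k))

/-- The index at which the block of `ε` that contains the index `k` begins: a block that begins
at `s` follows `b s` and ends at the first index where `ε` is smaller than `b s`. -/
def blockStart (b : ℕ+ → Coeff) (ε : Coeff) (k : ℕ+) : ℕ+ :=
  PNat.recOn k 1 fun k s => if ε k < b s k then k + 1 else s

/-- The coefficient functions that never exceed the current block maximum and complete infinitely
many blocks. -/
def admissible (b : ℕ+ → Coeff) : Set Coeff :=
  {ε | (∀ k, ε k ≤ b (blockStart b ε k) k) ∧ {k | ε k < b (blockStart b ε k) k}.Infinite}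

lemma blockStart_one : blockStart b ε 1 = 1 := rfl

lemma blockStart_add_one (k : ℕ+) : blockStart b ε (k + 1) =
    if ε k < b (blockStart b ε k) k then k + 1 else blockStart b ε k :=
  PNat.recOn_succ k _ _

lemma blockStart_add_one_of_lt (h : ε m < b (blockStart b ε m) m) :
    blockStart b ε (m + 1) = m + 1 := by
  rw [blockStart_add_one, if_pos h]

lemma blockStart_add_one_of_ge (h : b (blockStart b ε m) m ≤ ε m) :
    blockStart b ε (m + 1) = blockStart b ε m := by
  rw [blockStart_add_one, if_neg h.not_gt]

lemma blockStart_congr_of_le (hn : blockStart b ε n = blockStart b η n)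
    (h : ∀ k, n ≤ k → k < m → ε k = η k) (hnm : n ≤ m) :
    blockStart b ε m = blockStart b η m := by
  induction m, hnm using pnat_le_induction with
  | base => exact hn
  | succ m hnm ih =>
    rw [blockStart_add_one, blockStart_add_one,
      ih fun k hk hkm => h k hk (hkm.trans (PNat.lt_add_right m 1)),
      h m hnm (PNat.lt_add_right m 1)]

lemma blockStart_congr (h : ∀ k < m, ε k = η k) : blockStart b ε m = blockStart b η m :=
  blockStart_congr_of_le rfl (fun k _ => h k) one_le

lemma blockStart_eq_of_ge (h : ∀ k, n ≤ k → k < m → b (blockStart b ε k) k ≤ ε k)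
    (hnm : n ≤ m) : blockStart b ε m = blockStart b ε n := by
  induction m, hnm using pnat_le_induction with
  | base => rfl
  | succ m hnm ih => rw [blockStart_add_one_of_ge (h m hnm (PNat.lt_add_right m 1)),
      ih fun k hk hkm => h k hk (hkm.trans (PNat.lt_add_right m 1))]

lemma blockStart_eq_of_eq (hn : blockStart b ε n = n) (h : ∀ k, n ≤ k → k < m → ε k = b n k)
    (hnm : n ≤ m) : blockStart b ε m = n := by
  induction m, hnm using pnat_le_induction with
  | base => exact hn
  | succ m hnm ih =>
    have ih := ih fun k hk hkm => h k hk (hkm.trans (PNat.lt_add_right m 1))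
    rw [blockStart_add_one_of_ge, ih]
    rw [ih, h m hnm (PNat.lt_add_right m 1)]

lemma blockStart_eq_self_of_zero (ho : ∀ n, HasOrder (b n) n) (h : ∀ k < m, ε k = 0) :
    blockStart b ε m = m := by
  induction m using PNat.recOn with
  | one => rfl
  | succ m ih =>
    have ih := ih fun k hk => h k (hk.trans (PNat.lt_add_right m 1))
    refine blockStart_add_one_of_lt ?_
    rw [ih, h m (PNat.lt_add_right m 1)]
    exact (ho m).pos

lemma mem_admissible_of_finite (hi : ∀ n, InfSupport (b n))
    (h : ∀ k, ε k ≤ b (blockStart b ε k) k) (hm : ∀ k, m ≤ k → ε k = 0) :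
    ε ∈ admissible b := by
  refine ⟨h, fun hfin => ?_⟩
  obtain ⟨n, hn⟩ := hfin.bddAbove
  have hge : ∀ k, max m (n + 1) ≤ k → b (blockStart b ε k) k ≤ ε k := fun k hk =>
    not_lt.1 fun hlt => ((PNat.add_one_le_iff.1 ((le_max_right _ _).trans hk)).not_ge (hn hlt))
  obtain ⟨k, hk, hpos⟩ := (hi (blockStart b ε (max m (n + 1)))).exists_pos_of_le (max m (n + 1))
  have := hge k hk
  rw [blockStart_eq_of_ge (fun j hj _ => hge j hj) hk, hm k ((le_max_left _ _).trans hk)] at this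
  exact this.not_gt hpos

lemma zero_mem_admissible (hi : ∀ n, InfSupport (b n)) : (0 : Coeff) ∈ admissible b :=
  mem_admissible_of_finite (m := 1) hi (fun _ => Nat.zero_le _) fun _ _ => rfl

lemma basis_mem_admissible (ho : ∀ n, HasOrder (b n) n) (hi : ∀ n, InfSupport (b n)) (n : ℕ+) :
    basis n ∈ admissible b := by
  refine mem_admissible_of_finite (m := n + 1) hi (fun k => ?_)
    fun k hk => basis_of_ne (PNat.add_one_le_iff.1 hk).ne'
  obtain rfl | hk := eq_or_ne k n
  · rw [blockStart_eq_self_of_zero ho fun j hj => basis_of_ne hj.ne, basis_self]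
    exact (ho k).pos
  · rw [basis_of_ne hk]
    exact Nat.zero_le _

lemma mem_admissible_of_tail (hη : η ∈ admissible b)
    (hε : ∀ k < m, ε k ≤ b (blockStart b ε k) k) (h : ∀ k, m ≤ k → ε k = η k)
    (hm : blockStart b ε m = blockStart b η m) : ε ∈ admissible b := by
  have hst : ∀ k, m ≤ k → blockStart b ε k = blockStart b η k := fun k hk =>
    blockStart_congr_of_le hm (fun j hj _ => h j hj) hk
  refine ⟨fun k => ?_, Set.infinite_of_forall_exists_gt fun j => ?_⟩
  · rcases lt_or_ge k m with hk | hk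
    · exact hε k hk
    · rw [hst k hk, h k hk]
      exact hη.1 k
  · obtain ⟨k, hlt, hk⟩ := hη.2.exists_gt (max j m)
    have hmk : m ≤ k := (le_max_right j m).trans hk.le
    refine ⟨k, ?_, (le_max_left j m).trans_lt hk⟩
    rw [Set.mem_ofPred_eq, hst k hmk, h k hmk]
    exact hlt

/-- The intervals `[n m, i m]`, `m ≥ 1`, follow each other and cover the indices. -/
structure IsTiling (n i : ℕ+ → ℕ+) : Prop where
  first : n 1 = 1
  next : ∀ m, n (m + 1) = i m + 1
  le : ∀ m, n m ≤ i m

namespace IsTiling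

variable {n i : ℕ+ → ℕ+} {k l m : ℕ+}

lemma exists_mem (h : IsTiling n i) (k : ℕ+) : ∃ m, n m ≤ k ∧ k ≤ i m := by
  induction k using PNat.recOn with
  | one => exact ⟨1, h.first.le, one_le⟩
  | succ k ih =>
    obtain ⟨m, hm, hk⟩ := ih
    obtain rfl | hk := hk.eq_or_lt
    · exact ⟨m + 1, (h.next m).le, (h.next m).symm.le.trans (h.le _)⟩
    · exact ⟨m, hm.trans (PNat.lt_add_right k 1).le, PNat.add_one_le_iff.2 hk⟩

lemma strictMono (h : IsTiling n i) : StrictMono n :=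
  strictMono_of_lt_add_one fun m _ => (h.next m).symm ▸ PNat.lt_add_one_iff.2 (h.le m)

lemma le_of_mem (h : IsTiling n i) (hl : n l ≤ k) (hm : k ≤ i m) : l ≤ m := by
  by_contra! hlt
  have hle := h.strictMono.monotone (PNat.add_one_le_iff.2 hlt)
  rw [h.next] at hle
  exact (PNat.add_one_le_iff.1 (hle.trans hl)).not_ge hm

lemma unique (h : IsTiling n i) (hl : n l ≤ k ∧ k ≤ i l) (hm : n m ≤ k ∧ k ≤ i m) : l = m :=
  le_antisymm (h.le_of_mem hl.1 hm.2) (h.le_of_mem hm.1 hl.2)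

end IsTiling

lemma mem_determinedBy_iff : ε ∈ determinedBy b ↔ ∃ n i : ℕ+ → ℕ+, IsTiling n i ∧
    ∀ m, ε (i m) < b (n m) (i m) ∧ ∀ k, n m ≤ k → k < i m → ε k = b (n m) k := by
  constructor
  · rintro ⟨ζ, n, i, h1, hs, hblock, hε⟩
    have hT : IsTiling n i := ⟨h1, hs, fun m => (hblock m).le⟩
    have hval : ∀ m k, n m ≤ k → k ≤ i m → ε k = ζ m k := by
      intro m k hnk hki
      rw [hε, finsum_eq_single _ m]
      intro l hne
      apply (hblock l).eq_zero
      by_contra! hmem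
      exact hne (hT.unique hmem ⟨hnk, hki⟩)
    refine ⟨n, i, hT, fun m => ⟨?_, fun k hnk hki => ?_⟩⟩
    · rw [hval m _ (hT.le m) le_rfl]
      exact (hblock m).last_lt
    · rw [hval m k hnk hki.le, (hblock m).eq_before k hnk hki]
  · rintro ⟨n, i, hT, hε⟩
    have hζ : ∀ m k, n m ≤ k → k ≤ i m → (if n m ≤ k ∧ k ≤ i m then ε k else 0) = ε k :=
      fun m k hnk hki => if_pos ⟨hnk, hki⟩
    refine ⟨fun m k => if n m ≤ k ∧ k ≤ i m then ε k else 0, n, i, hT.first, hT.next,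
      fun m => ⟨hT.le m, ?_, fun k hnk hki => ?_, fun k hk => if_neg ?_⟩, fun k => ?_⟩
    · exact (hζ m _ (hT.le m) le_rfl).trans_lt (hε m).1
    · exact (hζ m k hnk hki.le).trans ((hε m).2 k hnk hki)
    · exact fun hmem => hk.elim hmem.1.not_gt hmem.2.not_gt
    · obtain ⟨m, hm⟩ := hT.exists_mem k
      rw [finsum_eq_single _ m fun l hne => if_neg fun hl => hne (hT.unique hl hm), if_pos hm]

lemma determinedBy_subset_admissible : determinedBy b ⊆ admissible b := by
  intro ε hε
  obtain ⟨n, i, hT, hε⟩ := mem_determinedBy_iff.1 hε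
  have hstart : ∀ m k, blockStart b ε (n m) = n m → n m ≤ k → k ≤ i m →
      blockStart b ε k = n m := fun m k hm hnk hki =>
    blockStart_eq_of_eq hm (fun j hj hjk => (hε m).2 j hj (hjk.trans_le hki)) hnk
  have hn : ∀ m, blockStart b ε (n m) = n m := by
    intro m
    induction m using PNat.recOn with
    | one => rw [hT.first, blockStart_one]
    | succ m ih =>
      rw [hT.next]
      apply blockStart_add_one_of_lt
      rw [hstart m _ ih (hT.le m) le_rfl]
      exact (hε m).1
  refine ⟨fun k => ?_, Set.infinite_of_forall_exists_gt fun k => ?_⟩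
  · obtain ⟨m, hnk, hki⟩ := hT.exists_mem k
    rw [hstart m k (hn m) hnk hki]
    obtain rfl | hki := hki.eq_or_lt
    · exact (hε m).1.le
    · exact ((hε m).2 k hnk hki).le
  · obtain ⟨m, -, hki⟩ := hT.exists_mem (k + 1)
    refine ⟨i m, ?_, PNat.add_one_le_iff.1 hki⟩
    rw [Set.mem_ofPred_eq, hstart m _ (hn m) (hT.le m) le_rfl]
    exact (hε m).1

lemma exists_block_end (hε : ε ∈ admissible b) (k : ℕ+) : ∃ i, k ≤ i ∧
    ε i < b (blockStart b ε i) i ∧ ∀ j, k ≤ j → j < i → ε j = b (blockStart b ε j) j := by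
  have hex : ∃ i, k ≤ i ∧ ε i < b (blockStart b ε i) i := by
    obtain ⟨i, hi, hk⟩ := hε.2.exists_gt k
    exact ⟨i, hk.le, hi⟩
  classical
  exact ⟨PNat.find hex, (PNat.find_spec hex).1, (PNat.find_spec hex).2, fun j hkj hj =>
    (hε.1 j).eq_of_not_lt fun hlt => PNat.find_min hex hj ⟨hkj, hlt⟩⟩

lemma admissible_subset_determinedBy : admissible b ⊆ determinedBy b := by
  intro ε hε
  choose last hle hlast hbefore using exists_block_end hε
  let n : ℕ+ → ℕ+ := fun m => PNat.recOn m 1 fun _ s => last s + 1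
  have hnext : ∀ m, n (m + 1) = last (n m) + 1 := fun m => PNat.recOn_succ m _ _
  have hn : ∀ m, blockStart b ε (n m) = n m := by
    intro m
    induction m using PNat.recOn with
    | one => rfl
    | succ m => rw [hnext, blockStart_add_one_of_lt (hlast _)]
  have hstart : ∀ m k, n m ≤ k → k ≤ last (n m) → blockStart b ε k = n m := by
    intro m k hnk hkl
    rw [blockStart_eq_of_ge (fun j hj hjk => (hbefore _ j hj (hjk.trans_le hkl)).ge) hnk, hn]
  refine mem_determinedBy_iff.2 ⟨n, fun m => last (n m), ⟨rfl, hnext, fun m => hle (n m)⟩,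
    fun m => ⟨?_, fun k hnk hkl => ?_⟩⟩
  · rw [← hstart m _ (hle (n m)) le_rfl]
    exact hlast (n m)
  · rw [← hstart m k hnk hkl.le]
    exact hbefore _ k hnk hkl

lemma determinedBy_eq_admissible : determinedBy b = admissible b :=
  determinedBy_subset_admissible.antisymm admissible_subset_determinedBy

/-- The terms of `Q` dominate the values of the block maxima: `∑ b n Q ≤ Q_{n-1}` for all `n`. -/
def SubRecursion (b : ℕ+ → Coeff) (Q : ℕ+ → ℝ) : Prop :=
  ∀ n, (Summable fun k => (b n k : ℝ) * Q k) ∧ value Q (b n) ≤ prevTerm Q n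

/-- The sum of `ε Q` before `m` plus what the block that contains `m` may still contribute. -/
noncomputable def potential (b : ℕ+ → Coeff) (Q : ℕ+ → ℝ) (ε : Coeff) (m : ℕ+) : ℝ :=
  prefixSum Q ε m +
    (value Q (b (blockStart b ε m)) - prefixSum Q (b (blockStart b ε m)) m)

lemma FullRecursion.value_eq (h : FullRecursion b Q) (n : ℕ+) : value Q (b n) = prevTerm Q n :=
  (h n).tsum_eq

lemma FullRecursion.subRecursion (h : FullRecursion b Q) : SubRecursion b Q := fun n =>
  ⟨(h n).summable, (h.value_eq n).le⟩

lemma le_prefixSum_of_ne_zero (hQ : ∀ k, 0 ≤ Q k) (h : ε n ≠ 0) (hnm : n < m) :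
    Q n ≤ prefixSum Q ε m :=
  calc Q n ≤ ε n * Q n :=
        le_mul_of_one_le_left (hQ n) (Nat.one_le_cast.2 (Nat.one_le_iff_ne_zero.2 h))
    _ ≤ prefixSum Q ε m :=
        Finset.single_le_sum (fun k _ => term_nonneg hQ k) (Finset.mem_Iio.2 hnm)

lemma potential_of_blockStart_eq_self (ho : ∀ n, HasOrder (b n) n) (h : blockStart b ε m = m) :
    potential b Q ε m = prefixSum Q ε m + value Q (b m) := by
  rw [potential, h, prefixSum_eq_zero fun k hk => (ho m).eq_zero_of_lt hk, sub_zero]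

lemma natCast_mul_add_le {c d : ℕ} (hcd : c < d) (ha : 0 ≤ a) : c * a + a ≤ d * a :=
  calc c * a + a = ((c + 1 : ℕ) : ℝ) * a := by push_cast; ring
    _ ≤ d * a := mul_le_mul_of_nonneg_right (Nat.cast_le.2 hcd) ha

namespace SubRecursion

lemma potential_add_one_lt (hS : SubRecursion b Q) (ho : ∀ n, HasOrder (b n) n)
    (hi : ∀ n, InfSupport (b n)) (hQ : ∀ k, 0 < Q k) (h : ε m < b (blockStart b ε m) m) :
    potential b Q ε (m + 1) < potential b Q ε m := by
  rw [potential_of_blockStart_eq_self ho (blockStart_add_one_of_lt h), potential,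
    prefixSum_add_one]
  have hrest := prefixSum_lt_value hQ (hS (blockStart b ε m)).1 (hi (blockStart b ε m)) (m + 1)
  rw [prefixSum_add_one] at hrest
  have hnext : value Q (b (m + 1)) ≤ Q m := prevTerm_add_one (Q := Q) ▸ (hS (m + 1)).2
  have hdigit := natCast_mul_add_le h (hQ m).le
  linarith

lemma potential_antitone (hS : SubRecursion b Q) (ho : ∀ n, HasOrder (b n) n)
    (hi : ∀ n, InfSupport (b n)) (hQ : ∀ k, 0 < Q k) (hε : ε ∈ admissible b) :
    Antitone (potential b Q ε) := by
  refine antitone_of_add_one_le fun m _ => ?_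
  obtain hlt | heq := (hε.1 m).lt_or_eq
  · exact (hS.potential_add_one_lt ho hi hQ hlt).le
  · rw [potential, potential, blockStart_add_one_of_ge heq.ge, prefixSum_add_one,
      prefixSum_add_one, ← heq]
    linarith

lemma prefixSum_le_potential (hS : SubRecursion b Q) (hQ : ∀ k, 0 ≤ Q k) (m : ℕ+) :
    prefixSum Q ε m ≤ potential b Q ε m :=
  le_add_of_nonneg_right (sub_nonneg.2 (prefixSum_le_value hQ (hS _).1 m))

lemma prefixSum_le_potential_of_admissible (hS : SubRecursion b Q) (ho : ∀ n, HasOrder (b n) n)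
    (hi : ∀ n, InfSupport (b n)) (hQ : ∀ k, 0 < Q k) (hε : ε ∈ admissible b) (l m : ℕ+) :
    prefixSum Q ε l ≤ potential b Q ε m :=
  (prefixSum_mono (fun k => (hQ k).le) (le_max_left l m)).trans
    ((hS.prefixSum_le_potential (fun k => (hQ k).le) _).trans
      (hS.potential_antitone ho hi hQ hε (le_max_right l m)))

lemma summable (hS : SubRecursion b Q) (ho : ∀ n, HasOrder (b n) n)
    (hi : ∀ n, InfSupport (b n)) (hQ : ∀ k, 0 < Q k) (hε : ε ∈ admissible b) :
    Summable fun k => (ε k : ℝ) * Q k :=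
  summable_of_prefixSum_le (fun k => (hQ k).le)
    fun l => hS.prefixSum_le_potential_of_admissible ho hi hQ hε l 1

lemma value_lt_prefixSum_add (hS : SubRecursion b Q) (ho : ∀ n, HasOrder (b n) n)
    (hi : ∀ n, InfSupport (b n)) (hQ : ∀ k, 0 < Q k) (hε : ε ∈ admissible b)
    (hm : blockStart b ε m = m) : value Q ε < prefixSum Q ε m + value Q (b m) := by
  obtain ⟨k, hmk, hk, -⟩ := exists_block_end hε m
  calc value Q ε ≤ potential b Q ε (k + 1) := value_le_of_prefixSum_le (fun k => (hQ k).le)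
        fun l => hS.prefixSum_le_potential_of_admissible ho hi hQ hε l (k + 1)
    _ < potential b Q ε k := hS.potential_add_one_lt ho hi hQ hk
    _ ≤ potential b Q ε m := hS.potential_antitone ho hi hQ hε hmk
    _ = prefixSum Q ε m + value Q (b m) := potential_of_blockStart_eq_self ho hm

lemma value_lt_value (hS : SubRecursion b Q) (ho : ∀ n, HasOrder (b n) n)
    (hi : ∀ n, InfSupport (b n)) (hQ : ∀ k, 0 < Q k) (hε : ε ∈ admissible b)
    (hη : η ∈ admissible b) (h : toLex ε < toLex η) : value Q ε < value Q η := by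
  obtain ⟨m, hbefore, hlt⟩ : ∃ m, (∀ k < m, ε k = η k) ∧ ε m < η m := h
  have hend : ε m < b (blockStart b ε m) m :=
    hlt.trans_le (blockStart_congr hbefore ▸ hη.1 m)
  calc value Q ε < prefixSum Q ε (m + 1) + value Q (b (m + 1)) :=
        hS.value_lt_prefixSum_add ho hi hQ hε (blockStart_add_one_of_lt hend)
    _ ≤ prefixSum Q ε (m + 1) + Q m := by
        gcongr
        exact prevTerm_add_one (Q := Q) ▸ (hS (m + 1)).2
    _ ≤ prefixSum Q η (m + 1) := by
        rw [prefixSum_add_one, prefixSum_add_one, prefixSum_congr hbefore, add_assoc]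
        gcongr
        exact natCast_mul_add_le hlt (hQ m).le
    _ ≤ value Q η := prefixSum_le_value (fun k => (hQ k).le) (hS.summable ho hi hQ hη) _

lemma injOn_value (hS : SubRecursion b Q) (ho : ∀ n, HasOrder (b n) n)
    (hi : ∀ n, InfSupport (b n)) (hQ : ∀ k, 0 < Q k) : Set.InjOn (value Q) (admissible b) := by
  intro ε hε η hη h
  by_contra hne
  obtain hlt | hlt := lt_or_gt_of_ne (toLex.injective.ne hne)
  · exact (hS.value_lt_value ho hi hQ hε hη hlt).ne h
  · exact (hS.value_lt_value ho hi hQ hη hε hlt).ne h.symm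

end SubRecursion

namespace FullRecursion

lemma lt_prevTerm (h : FullRecursion b Q) (ho : ∀ n, HasOrder (b n) n)
    (hi : ∀ n, InfSupport (b n)) (hQ : ∀ k, 0 < Q k) (n : ℕ+) : Q n < prevTerm Q n :=
  calc Q n ≤ prefixSum Q (b n) (n + 1) :=
        le_prefixSum_of_ne_zero (fun k => (hQ k).le) (ho n).1 (PNat.lt_add_right n 1)
    _ < value Q (b n) := prefixSum_lt_value hQ (h n).summable (hi n) (n + 1)
    _ = prevTerm Q n := h.value_eq n

lemma strictAnti (h : FullRecursion b Q) (ho : ∀ n, HasOrder (b n) n)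
    (hi : ∀ n, InfSupport (b n)) (hQ : ∀ k, 0 < Q k) : StrictAnti Q :=
  strictAnti_of_add_one_lt fun n _ =>
    (h.lt_prevTerm ho hi hQ (n + 1)).trans_eq prevTerm_add_one

lemma lt_one (h : FullRecursion b Q) (ho : ∀ n, HasOrder (b n) n)
    (hi : ∀ n, InfSupport (b n)) (hQ : ∀ k, 0 < Q k) (k : ℕ+) : Q k < 1 :=
  ((h.strictAnti ho hi hQ).antitone one_le).trans_lt
    (prevTerm_one (Q := Q) ▸ h.lt_prevTerm ho hi hQ 1)

end FullRecursion

lemma tendsto_zero_of_summable (hQ : ∀ k, 0 < Q k) (hanti : Antitone Q) (hi : InfSupport ε)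
    (hs : Summable fun k => (ε k : ℝ) * Q k) : Filter.Tendsto Q Filter.atTop (nhds 0) := by
  refine tendsto_order.2 ⟨fun r hr => .of_forall fun k => hr.trans (hQ k), fun r hr => ?_⟩
  have hterm : ∀ᶠ k in Filter.atTop, (ε k : ℝ) * Q k < r := by
    have := hs.tendsto_cofinite_zero.eventually (gt_mem_nhds hr)
    exact this.filter_mono Filter.atTop_le_cofinite
  obtain ⟨M, hM⟩ := Filter.eventually_atTop.1 hterm
  obtain ⟨k, hMk, hk⟩ := hi.exists_pos_of_le M
  filter_upwards [Filter.eventually_ge_atTop k] with j hkj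
  calc Q j ≤ Q k := hanti hkj
    _ ≤ ε k * Q k := le_mul_of_one_le_left (hQ k).le (Nat.one_le_cast.2 hk)
    _ < r := hM k hMk

/-- The greedy expansion of `x`: every digit is as large as the remainder and the current block
maximum permit. -/
noncomputable def greedy (b : ℕ+ → Coeff) (Q : ℕ+ → ℝ) (x : ℝ) (k : ℕ+) : ℕ :=
  let ε : Coeff := fun j => if _hj : j < k then greedy b Q x j else 0
  min ⌊(x - prefixSum Q ε k) / Q k⌋₊ (b (blockStart b ε k) k)
termination_by k

lemma greedy_apply (b : ℕ+ → Coeff) (Q : ℕ+ → ℝ) (x : ℝ) (k : ℕ+) : greedy b Q x k =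
    min ⌊(x - prefixSum Q (greedy b Q x) k) / Q k⌋₊ (b (blockStart b (greedy b Q x) k) k) := by
  have hagree : ∀ j < k, (if _hj : j < k then greedy b Q x j else 0) = greedy b Q x j :=
    fun j hj => dif_pos hj
  rw [greedy, prefixSum_congr hagree, blockStart_congr hagree]

lemma greedy_le (x : ℝ) (k : ℕ+) :
    greedy b Q x k ≤ b (blockStart b (greedy b Q x) k) k := by
  rw [greedy_apply]
  exact min_le_right _ _

lemma prefixSum_greedy_le (hQ : ∀ k, 0 < Q k) {x : ℝ} (hx : 0 ≤ x) (m : ℕ+) :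
    prefixSum Q (greedy b Q x) m ≤ x := by
  induction m using PNat.recOn with
  | one => rwa [prefixSum_one]
  | succ m ih =>
    have hfloor : (greedy b Q x m : ℝ) ≤ (x - prefixSum Q (greedy b Q x) m) / Q m := by
      refine le_trans ?_ (Nat.floor_le (div_nonneg (sub_nonneg.2 ih) (hQ m).le))
      rw [greedy_apply]
      exact Nat.cast_le.2 (min_le_left _ _)
    rw [le_div_iff₀ (hQ m)] at hfloor
    rw [prefixSum_add_one]
    linarith

lemma sub_prefixSum_greedy_lt (ho : ∀ n, HasOrder (b n) n) (hQ : ∀ k, 0 < Q k) {x : ℝ}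
    (hx : x < 1) (m : ℕ+) : x - prefixSum Q (greedy b Q x) m <
      prevTerm Q (blockStart b (greedy b Q x) m) -
        prefixSum Q (b (blockStart b (greedy b Q x) m)) m := by
  induction m using PNat.recOn with
  | one => simpa [prefixSum_one, blockStart_one, prevTerm_one]
  | succ m ih =>
    obtain hlt | heq := (greedy_le (b := b) (Q := Q) x m).lt_or_eq
    · have hdigit : greedy b Q x m = ⌊(x - prefixSum Q (greedy b Q x) m) / Q m⌋₊ :=
        (greedy_apply b Q x m).trans <| (min_choice _ _).resolve_right
          fun h => hlt.ne ((greedy_apply b Q x m).trans h)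
      have hfloor := Nat.lt_floor_add_one ((x - prefixSum Q (greedy b Q x) m) / Q m)
      rw [← hdigit, div_lt_iff₀ (hQ m)] at hfloor
      rw [blockStart_add_one_of_lt hlt, prevTerm_add_one, prefixSum_add_one,
        prefixSum_eq_zero fun k hk => (ho (m + 1)).eq_zero_of_lt hk]
      linarith
    · rw [blockStart_add_one_of_ge heq.ge, prefixSum_add_one, prefixSum_add_one, ← heq]
      linarith

namespace FullRecursion

lemma greedy_mem_admissible (h : FullRecursion b Q) (ho : ∀ n, HasOrder (b n) n)
    (hQ : ∀ k, 0 < Q k) {x : ℝ} (hx : x ∈ Set.Ico 0 1) : greedy b Q x ∈ admissible b := by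
  refine ⟨greedy_le x, fun hfin => ?_⟩
  obtain ⟨M, hM⟩ := hfin.bddAbove
  have hge : ∀ k, M + 1 ≤ k →
      b (blockStart b (greedy b Q x) k) k ≤ greedy b Q x k := fun k hk =>
    not_lt.1 fun hlt => (PNat.add_one_le_iff.1 hk).not_ge (hM hlt)
  set n := blockStart b (greedy b Q x) (M + 1)
  have hgap : ∀ k, M + 1 ≤ k → prefixSum Q (b n) k - prefixSum Q (greedy b Q x) k =
      prefixSum Q (b n) (M + 1) - prefixSum Q (greedy b Q x) (M + 1) := by
    intro k hk
    induction k, hk using pnat_le_induction with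
    | base => rfl
    | succ k hk ih =>
      have hdigit := (greedy_le (b := b) (Q := Q) x k).antisymm (hge k hk)
      rw [blockStart_eq_of_ge (fun j hj _ => hge j hj) hk] at hdigit
      rw [prefixSum_add_one, prefixSum_add_one, hdigit, ← ih]
      ring
  have hlim : prevTerm Q n ≤
      x + (prefixSum Q (b n) (M + 1) - prefixSum Q (greedy b Q x) (M + 1)) := by
    refine le_of_tendsto (tendsto_prefixSum (h n)) ?_
    filter_upwards [Filter.eventually_ge_atTop (M + 1)] with k hk
    linarith [hgap k hk, prefixSum_greedy_le (b := b) hQ hx.1 k]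
  linarith [sub_prefixSum_greedy_lt ho hQ hx.2 (M + 1)]

lemma value_greedy (h : FullRecursion b Q) (ho : ∀ n, HasOrder (b n) n)
    (hi : ∀ n, InfSupport (b n)) (hQ : ∀ k, 0 < Q k) {x : ℝ} (hx : x ∈ Set.Ico 0 1) :
    value Q (greedy b Q x) = x := by
  have hle := prefixSum_greedy_le (b := b) hQ hx.1
  have hs := summable_of_prefixSum_le (fun k => (hQ k).le) hle
  refine le_antisymm (value_le_of_prefixSum_le (fun k => (hQ k).le) hle)
    (le_of_forall_pos_le_add fun r hr => ?_)
  have hQ0 := tendsto_zero_of_summable hQ (h.strictAnti ho hi hQ).antitone (hi 1)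
    (h 1).summable
  obtain ⟨M, hM⟩ := Filter.eventually_atTop.1 (hQ0.eventually (gt_mem_nhds hr))
  obtain ⟨k, hMk, hk, -⟩ := exists_block_end (h.greedy_mem_admissible ho hQ hx) M
  have hrem := sub_prefixSum_greedy_lt ho hQ hx.2 (k + 1)
  rw [blockStart_add_one_of_lt hk, prevTerm_add_one,
    prefixSum_eq_zero fun j hj => (ho (k + 1)).eq_zero_of_lt hj] at hrem
  linarith [hM k hMk, prefixSum_le_value (fun k => (hQ k).le) hs (k + 1)]

theorem isFundamental (h : FullRecursion b Q) (ho : ∀ n, HasOrder (b n) n)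
    (hi : ∀ n, InfSupport (b n)) (hQ : ∀ k, 0 < Q k) :
    IsFundamental (determinedBy b) (Set.Ioo 0 1) Q := by
  have hS := h.subRecursion
  rw [determinedBy_eq_admissible]
  refine ⟨fun k => ⟨hQ k, h.lt_one ho hi hQ k⟩,
    ⟨fun ε hε => hS.summable ho hi hQ hε, hS.injOn_value ho hi hQ⟩,
    Set.Subset.antisymm ?_ fun x hx => ?_⟩
  · rintro _ ⟨ε, ⟨hε, h0⟩, rfl⟩
    refine ⟨value_pos hQ (hS.summable ho hi hQ hε) h0, ?_⟩
    simpa [prefixSum_one, h.value_eq, prevTerm_one] using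
      hS.value_lt_prefixSum_add ho hi hQ hε blockStart_one
  · have hv := h.value_greedy ho hi hQ ⟨hx.1.le, hx.2⟩
    refine ⟨greedy b Q x, ⟨h.greedy_mem_admissible ho hQ ⟨hx.1.le, hx.2⟩, fun h0 => ?_⟩, hv⟩
    rw [Set.mem_singleton_iff.1 h0, value_zero] at hv
    exact hx.1.ne hv

end FullRecursion

lemma prevTerm_le_of_lt (hanti : Antitone Q) (h : m < n) : prevTerm Q n ≤ Q m := by
  obtain ⟨l, rfl⟩ := PNat.exists_eq_succ_of_ne_one (one_le.trans_lt h).ne'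
  rw [prevTerm_add_one]
  exact hanti (PNat.lt_add_one_iff.1 h)

lemma eq_zero_of_value_lt (hQ : ∀ k, 0 ≤ Q k) (hanti : Antitone Q)
    (hs : Summable fun k => (ε k : ℝ) * Q k) (h : value Q ε < prevTerm Q n) :
    ∀ k < n, ε k = 0 := by
  intro k hk
  by_contra hne
  exact h.not_ge ((prevTerm_le_of_lt hanti hk).trans
    ((le_prefixSum_of_ne_zero hQ hne (PNat.lt_add_right k 1)).trans (prefixSum_le_value hQ hs _)))

lemma value_eq_prefixSum_add (hε : Summable fun k => (ε k : ℝ) * Q k)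
    (hη : Summable fun k => (η k : ℝ) * Q k) (hzero : ∀ k < m, η k = 0)
    (htail : ∀ k, m ≤ k → ε k = η k) : value Q ε = prefixSum Q ε m + value Q η := by
  rw [← sub_eq_iff_eq_add, value, value, ← hε.tsum_sub hη, tsum_eq_sum (s := Finset.Iio m)]
  · exact Finset.sum_congr rfl fun k hk => by simp [hzero k (Finset.mem_Iio.1 hk)]
  · intro k hk
    rw [htail k (not_lt.1 fun h => hk (Finset.mem_Iio.2 h)), sub_self]

lemma exists_admissible_block_add {i : ℕ+} {c : ℕ} (ho : ∀ n, HasOrder (b n) n) (hni : n ≤ i)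
    (hc : c < b n i) (hη : η ∈ admissible b) (hzero : ∀ k < i + 1, η k = 0) :
    ∃ ε ∈ admissible b, (∀ k < i, ε k = b n k) ∧ ε i = c ∧ ∀ k, i + 1 ≤ k → ε k = η k := by
  let ε : Coeff := fun k => if k < i then b n k else if k = i then c else η k
  have hbefore : ∀ k < i, ε k = b n k := fun k hk => if_pos hk
  have hat : ε i = c := by simp [ε]
  have htail : ∀ k, i + 1 ≤ k → ε k = η k := fun k hk => by
    have hik := PNat.add_one_le_iff.1 hk
    simp [ε, hik.not_gt, hik.ne']
  have hzero_n : ∀ k < n, ε k = 0 := fun k hk =>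
    (hbefore k (hk.trans_le hni)).trans ((ho n).eq_zero_of_lt hk)
  have hstart : ∀ k, n ≤ k → k ≤ i → blockStart b ε k = n := fun k hnk hki =>
    blockStart_eq_of_eq (blockStart_eq_self_of_zero ho hzero_n)
      (fun j _ hj => hbefore j (hj.trans_le hki)) hnk
  have hend : blockStart b ε (i + 1) = i + 1 :=
    blockStart_add_one_of_lt (by rwa [hstart i hni le_rfl, hat])
  refine ⟨ε, mem_admissible_of_tail hη (fun k hk => ?_) htail
    (hend.trans (blockStart_eq_self_of_zero ho hzero).symm), hbefore, hat, htail⟩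
  obtain hkn | hnk := lt_or_ge k n
  · exact (hzero_n k hkn).trans_le (Nat.zero_le _)
  obtain rfl | hki := (PNat.lt_add_one_iff.1 hk).eq_or_lt
  · rw [hstart k hnk le_rfl, hat]
    exact hc.le
  · rw [hstart k hnk hki.le, hbefore k hki]

lemma exists_natCast_mul_le_and_lt {x : ℝ} (ha : 0 < a) (hx : 0 ≤ x) :
    ∃ c : ℕ, c * a ≤ x ∧ x < (c + 1) * a :=
  ⟨⌊x / a⌋₊, (le_div_iff₀ ha).1 (Nat.floor_le (div_nonneg hx ha.le)),
    (div_lt_iff₀ ha).1 (Nat.lt_floor_add_one _)⟩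

namespace IsFundamental

variable {E : Set Coeff}

lemma value_lt_one (h : IsFundamental E (Set.Ioo 0 1) Q) (hε : ε ∈ E) : value Q ε < 1 := by
  obtain rfl | h0 := eq_or_ne ε 0
  · rw [value_zero]
    exact one_pos
  · have hv : value Q ε ∈ valueSet E Q := ⟨ε, ⟨hε, h0⟩, rfl⟩
    exact (h.2.2 ▸ hv).2

lemma exists_value_eq (h : IsFundamental E (Set.Ioo 0 1) Q) (h0 : (0 : Coeff) ∈ E) {x : ℝ}
    (hx : x ∈ Set.Ico 0 1) : ∃ ε ∈ E, value Q ε = x := by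
  obtain rfl | hpos := hx.1.eq_or_lt
  · exact ⟨0, h0, value_zero⟩
  · have hv : x ∈ valueSet E Q := h.2.2 ▸ ⟨hpos, hx.2⟩
    obtain ⟨ε, hε, rfl⟩ := hv
    exact ⟨ε, hε.1, rfl⟩

/-- For `n = m + 1` the second representation of `prevTerm Q n = Q m` would be `basis m`. -/
lemma eq_zero_imp_value_ne_prevTerm (h : IsFundamental (admissible b) (Set.Ioo 0 1) Q)
    (ho : ∀ n, HasOrder (b n) n) (hi : ∀ n, InfSupport (b n)) (hε : ε ∈ admissible b)
    (hzero : ∀ k < n, ε k = 0) : value Q ε ≠ prevTerm Q n := by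
  induction n using PNat.recOn with
  | one => exact prevTerm_one (Q := Q) ▸ (h.value_lt_one hε).ne
  | succ n =>
    intro hv
    have heq : ε = basis n := h.2.1.2 hε (basis_mem_admissible ho hi n) <| by
      rw [hv, value_basis, prevTerm_add_one]
    have := hzero n (PNat.lt_add_right n 1)
    rw [heq, basis_self] at this
    exact one_ne_zero this

/-- Otherwise the first partial sum that exceeds `Q_{n-1}` yields a second representation of
`Q_{n-1}`: lower its last digit as little as possible and expand the remainder. -/
lemma prefixSum_le_prevTerm (h : IsFundamental (admissible b) (Set.Ioo 0 1) Q)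
    (hanti : Antitone Q) (ho : ∀ n, HasOrder (b n) n) (hi : ∀ n, InfSupport (b n)) (n m : ℕ+) :
    prefixSum Q (b n) m ≤ prevTerm Q n := by
  have hQ : ∀ k, 0 < Q k := fun k => (h.1 k).1
  induction m using PNat.recOn with
  | one => exact prefixSum_one.trans_le (prevTerm_pos hQ n).le
  | succ i ih =>
    by_contra! hexceeds
    have hni : n ≤ i := by
      by_contra! hin
      rw [prefixSum_eq_zero fun k hk =>
        (ho n).eq_zero_of_lt (hk.trans_le (PNat.add_one_le_iff.2 hin))] at hexceeds
      exact hexceeds.not_gt (prevTerm_pos hQ n)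
    obtain ⟨c, hc_le, hlt_c⟩ := exists_natCast_mul_le_and_lt (hQ i) (sub_nonneg.2 ih)
    have hcb : c < b n i := by
      rw [prefixSum_add_one] at hexceeds
      exact Nat.cast_lt.1 (lt_of_mul_lt_mul_right (by linarith) (hQ i).le : (c : ℝ) < b n i)
    obtain ⟨η, hη, hηv⟩ := h.exists_value_eq (zero_mem_admissible hi)
      (x := prevTerm Q n - prefixSum Q (b n) i - c * Q i)
      ⟨by linarith, by linarith [(h.1 i).2]⟩
    have hη0 : ∀ k < i + 1, η k = 0 :=
      eq_zero_of_value_lt (fun k => (hQ k).le) hanti (h.2.1.1 η hη)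
        (by rw [prevTerm_add_one]; linarith)
    obtain ⟨ε, hε, hbefore, hat, htail⟩ := exists_admissible_block_add ho hni hcb hη hη0
    refine h.eq_zero_imp_value_ne_prevTerm ho hi hε (n := n) (fun k hk =>
      (hbefore k (hk.trans_le hni)).trans ((ho n).eq_zero_of_lt hk)) ?_
    rw [value_eq_prefixSum_add (h.2.1.1 ε hε) (h.2.1.1 η hη) hη0 htail, prefixSum_add_one,
      prefixSum_congr hbefore, hat, hηv]
    ring

theorem fullRecursion (h : IsFundamental (determinedBy b) (Set.Ioo 0 1) Q)
    (hanti : Antitone Q) (ho : ∀ n, HasOrder (b n) n) (hi : ∀ n, InfSupport (b n)) :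
    FullRecursion b Q := by
  rw [determinedBy_eq_admissible] at h
  have hQ : ∀ k, 0 < Q k := fun k => (h.1 k).1
  have hnonneg : ∀ k, 0 ≤ Q k := fun k => (hQ k).le
  have hS : SubRecursion b Q := fun n =>
    ⟨summable_of_prefixSum_le hnonneg (h.prefixSum_le_prevTerm hanti ho hi n),
      value_le_of_prefixSum_le hnonneg (h.prefixSum_le_prevTerm hanti ho hi n)⟩
  intro n
  suffices hv : value Q (b n) = prevTerm Q n from (hS n).1.hasSum_iff.2 hv
  refine (hS n).2.antisymm (not_lt.1 fun hlt => ?_)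
  obtain ⟨ε, hε, hv⟩ := h.exists_value_eq (zero_mem_admissible hi) (x := value Q (b n))
    ⟨value_nonneg hnonneg, hlt.trans_le (prevTerm_le_one (fun k => (h.1 k).2.le) n)⟩
  have hzero : ∀ k < n, ε k = 0 :=
    eq_zero_of_value_lt hnonneg hanti (h.2.1.1 ε hε) (hv ▸ hlt)
  have hstrict := hS.value_lt_prefixSum_add ho hi hQ hε (blockStart_eq_self_of_zero ho hzero)
  rw [prefixSum_eq_zero hzero, zero_add, hv] at hstrict
  exact hstrict.false

end IsFundamental

theorem isFundamental_determinedBy_iff (hanti : Antitone Q) (hQ : ∀ k, 0 < Q k)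
    (ho : ∀ n, HasOrder (b n) n) (hi : ∀ n, InfSupport (b n)) :
    IsFundamental (determinedBy b) (Set.Ioo 0 1) Q ↔ FullRecursion b Q :=
  ⟨fun h => h.fullRecursion hanti ho hi, fun h => h.isFundamental ho hi hQ⟩

section Zeckendorf

variable {E X : Set Coeff} {x y z ρ : Coeff} {k M : ℕ+}

lemma eq_of_lex_between (hxy : toLex x < toLex y) (hyz : toLex y ≤ toLex z)
    (h : ∀ k < M, x k = z k) : ∀ k < M, y k = x k := by
  obtain ⟨i, hbefore, hlt⟩ : ∃ i, (∀ j < i, x j = y j) ∧ x i < y i := hxy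
  obtain hiM | hMi := lt_or_ge i M
  · refine absurd hyz (not_le.2 ⟨i, fun j hj => ?_, ?_⟩)
    · exact (h j (hj.trans hiM)).symm.trans (hbefore j hj)
    · exact (h i hiM).symm.trans_lt hlt
  · exact fun k hk => (hbefore k (hk.trans_le hMi)).symm

lemma apply_lt_of_lex_lt (hxy : toLex x < toLex y) (h : ∀ k < M, x k = y k)
    (hy : ∀ k, M < k → y k = 0) : x M < y M := by
  obtain ⟨i, -, hlt⟩ : ∃ i, (∀ j < i, x j = y j) ∧ x i < y i := hxy
  obtain hiM | rfl | hMi := lt_trichotomy i M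
  · exact absurd (h i hiM) hlt.ne
  · exact hlt
  · exact absurd (hy i hMi) hlt.ne_bot

lemma zero_lex_lt (h : x ≠ 0) : toLex (0 : Coeff) < toLex x :=
  lt_of_le_of_ne (Pi.toLex_monotone fun _ => Nat.zero_le _) (toLex.injective.ne h.symm)

lemma add_basis_apply_of_ne (h : k ≠ M) : (ε + basis M) k = ε k := by
  rw [Pi.add_apply, basis_of_ne h, add_zero]

lemma add_basis_apply_self : (ε + basis M) M = ε M + 1 := by
  rw [Pi.add_apply, basis_self]

lemma res_apply_of_le (h : k ≤ M) : res M ε k = ε k := if_pos h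

lemma res_apply_of_lt (h : M < k) : res M ε k = 0 := if_neg h.not_ge

lemma trunc_apply_of_lt (hx : x ∈ trunc E M) (h : M < k) : x k = 0 := by
  obtain ⟨η, -, rfl⟩ := hx
  exact res_apply_of_lt h

lemma res_congr (h : ∀ k ≤ M, ε k = η k) : res M ε = res M η := by
  ext k
  obtain hk | hk := le_or_gt k M
  · rw [res_apply_of_le hk, res_apply_of_le hk, h k hk]
  · rw [res_apply_of_lt hk, res_apply_of_lt hk]

lemma res_eq_of_agree (hx : x ∈ trunc E M) (h : ∀ k ≤ M, ε k = x k) : res M ε = x := by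
  ext k
  obtain hk | hk := le_or_gt k M
  · rw [res_apply_of_le hk, h k hk]
  · rw [res_apply_of_lt hk, trunc_apply_of_lt hx hk]

lemma res_mem_trunc_of_le (hm : m ≤ M) (h : res M ε ∈ trunc E M) : res m ε ∈ trunc E m := by
  obtain ⟨η, hη, heq⟩ := h
  refine ⟨η, hη, res_congr fun k hk => ?_⟩
  rw [← res_apply_of_le (ε := η) (hk.trans hm), heq, res_apply_of_le (hk.trans hm)]

lemma exists_mem_trunc_agree (hE : E.Nonempty) (h : ∀ m < M, res m ε ∈ trunc E m) :
    ∃ ρ ∈ trunc E M, ∀ k < M, ρ k = ε k := by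
  induction M using PNat.recOn with
  | one => exact ⟨_, ⟨hE.some, hE.some_mem, rfl⟩, fun k hk => absurd hk not_lt_one⟩
  | succ m =>
    obtain ⟨η, hη, heq⟩ := h m (PNat.lt_add_right m 1)
    refine ⟨_, ⟨η, hη, rfl⟩, fun k hk => ?_⟩
    have hkm : k ≤ m := PNat.lt_add_one_iff.1 hk
    rw [res_apply_of_le hk.le, ← res_apply_of_le (ε := η) hkm, heq, res_apply_of_le hkm]

lemma exists_isImmSucc (hX : X.Finite) (hz : z ∈ X) (h : toLex x < toLex z) :
    ∃ ν, IsImmSucc X x ν := by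
  obtain ⟨ν, ⟨hν, hlt⟩, hmin⟩ := Set.exists_min_image {y ∈ X | toLex x < toLex y} toLex
    (hX.subset fun y hy => hy.1) ⟨z, hz, h⟩
  exact ⟨ν, hν, hlt, fun y hy hxy => hmin y ⟨hy, hxy⟩⟩

lemma exists_isImmSucc_of_lt (hX : X.Finite) (hx : x ∈ X) (hz : z ∈ X) (h : toLex z < toLex x) :
    ∃ p ∈ X, IsImmSucc X p x := by
  obtain ⟨p, ⟨hp, hlt⟩, hmax⟩ := Set.exists_max_image {y ∈ X | toLex y < toLex x} toLex
    (hX.subset fun y hy => hy.1) ⟨z, hz, h⟩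
  exact ⟨p, hp, hx, hlt, fun y hy hpy => not_lt.1 fun hyx => (hmax y ⟨hy, hyx⟩).not_gt hpy⟩

lemma isImmSucc_add_basis_iff : IsImmSucc (trunc E M) (res M ε) (res M (ε + basis M)) ↔
    res M (ε + basis M) ∈ trunc E M := by
  have hagree : ∀ k < M, res M ε k = res M (ε + basis M) k := fun k hk => by
    rw [res_apply_of_le hk.le, res_apply_of_le hk.le, add_basis_apply_of_ne hk.ne]
  have hstep : res M (ε + basis M) M = res M ε M + 1 := by
    rw [res_apply_of_le le_rfl, res_apply_of_le le_rfl, add_basis_apply_self]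
  refine ⟨fun h => h.1, fun h => ⟨h, ⟨M, hagree, (Nat.lt_succ_self _).trans_eq hstep.symm⟩,
    fun x hx hlt => ?_⟩⟩
  by_contra! hgt
  have hx_agree := eq_of_lex_between hlt hgt.le hagree
  have hlow : res M ε M < x M := apply_lt_of_lex_lt hlt (fun k hk => (hx_agree k hk).symm)
    fun k => trunc_apply_of_lt hx
  have hhigh : x M < res M (ε + basis M) M :=
    apply_lt_of_lex_lt hgt (fun k hk => (hx_agree k hk).trans (hagree k hk))
      fun k => res_apply_of_lt
  omega

namespace IsZeckendorf

lemma trunc_finite (hE : IsZeckendorf E) {β : Coeff} (hβ : IsMaximal E 1 β) (M : ℕ+) :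
    (trunc E M).Finite := by
  obtain ⟨hmem, hmax⟩ := hβ.first rfl M
  refine ((hE.finite_below M _ hmem).insert (res M β)).subset fun x hx => ?_
  exact (hmax x hx).eq_or_lt.imp (fun h => toLex.injective h) fun h => ⟨hx, h⟩

/-- In the finite set `trunc E M`, the smallest continuation of the prefix of `ρ` by a digit at
least `c` has digit exactly `c`, since its immediate predecessor is obtained by subtracting
`basis M`. -/
lemma exists_digit_eq (hE : IsZeckendorf E) (hb : ∀ n, IsMaximal E n (b n))
    (hρ : ρ ∈ trunc E M) {c : ℕ} (hc : c ≤ ρ M) :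
    ∃ x ∈ trunc E M, (∀ k < M, x k = ρ k) ∧ x M = c := by
  have hfin := hE.trunc_finite (hb 1) M
  obtain ⟨x, ⟨hx, hxρ, hcx⟩, hmin⟩ := Set.exists_min_image
    {y ∈ trunc E M | (∀ k < M, y k = ρ k) ∧ c ≤ y M} toLex (hfin.subset fun y hy => hy.1)
    ⟨ρ, hρ, fun _ _ => rfl, hc⟩
  refine ⟨x, hx, hxρ, hcx.antisymm' (not_lt.1 fun hlt => ?_)⟩
  have h0 : (0 : Coeff) ∈ trunc E M := ⟨0, hE.zero_mem, funext fun _ => ite_self 0⟩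
  obtain ⟨p, hp, hsucc⟩ := exists_isImmSucc_of_lt hfin hx h0
    (zero_lex_lt fun h => hlt.ne_bot (congrFun h M))
  have hpx : x = p + basis M := by
    by_contra hne
    obtain ⟨n, hnM, -, hform⟩ := hE.succ_form b hb M p hp
      (hsucc.2.1.trans_le (((hb 1).first rfl M).2 x hx)) x hsucc hne
    have hxM : x M = 0 := by
      rw [hform, add_basis_apply_of_ne hnM.ne', res_apply_of_lt hnM]
    exact hlt.ne_bot hxM
  refine (hmin p ⟨hp, fun k hk => ?_, ?_⟩).not_gt hsucc.2.1
  · rw [← hxρ k hk, hpx, add_basis_apply_of_ne hk.ne]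
  · rw [hpx, add_basis_apply_self] at hlt
    exact Nat.lt_succ_iff.1 hlt

/-- The largest continuation of the prefix of `ρ` is either the largest element of `trunc E M` or
its immediate successor changes an earlier digit; in both cases it ends with a block maximum. -/
lemma exists_max_digit (hE : IsZeckendorf E) (hb : ∀ n, IsMaximal E n (b n))
    (ih : ∀ m < M, ∀ ε, res m ε ∈ trunc E m → ε m ≤ b (blockStart b ε m) m)
    (hρ : ρ ∈ trunc E M) :
    ∃ x ∈ trunc E M, (∀ k < M, x k = ρ k) ∧ x M = b (blockStart b ρ M) M ∧ ρ M ≤ x M := by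
  have hfin := hE.trunc_finite (hb 1) M
  obtain ⟨x, ⟨hx, hxρ⟩, hmax⟩ := Set.exists_max_image
    {y ∈ trunc E M | ∀ k < M, y k = ρ k} toLex (hfin.subset fun y hy => hy.1)
    ⟨ρ, hρ, fun _ _ => rfl⟩
  refine ⟨x, hx, hxρ, ?_, not_lt.1 fun hlt =>
    (hmax ρ ⟨hρ, fun _ _ => rfl⟩).not_gt ⟨M, hxρ, hlt⟩⟩
  rw [← blockStart_congr hxρ]
  obtain htop | hlt := (((hb 1).first rfl M).2 x hx).eq_or_lt
  · have hxb : ∀ k ≤ M, x k = b 1 k := fun k hk => by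
      rw [toLex.injective htop, res_apply_of_le hk]
    rw [blockStart_eq_of_eq blockStart_one (fun k _ hk => hxb k hk.le) one_le, hxb M le_rfl]
  · obtain ⟨ν, hν⟩ := exists_isImmSucc hfin ((hb 1).first rfl M).1 hlt
    obtain ⟨n, hnM, htail, hform⟩ := hE.succ_form b hb M x hx hlt ν hν fun heq =>
      (hmax ν ⟨hν.1, fun k hk => by
        rw [heq, add_basis_apply_of_ne hk.ne, hxρ k hk]⟩).not_gt hν.2.1
    have hνx : ∀ k < n, ν k = x k := fun k hk => by
      rw [hform, add_basis_apply_of_ne hk.ne, res_apply_of_le hk.le]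
    have hνn : ν n = x n + 1 := by
      rw [hform, add_basis_apply_self, res_apply_of_le le_rfl]
    have hend : x n < b (blockStart b x n) n := by
      rw [← Nat.succ_le_iff, ← blockStart_congr hνx, Nat.succ_eq_add_one, ← hνn]
      exact ih n hnM ν (res_mem_trunc_of_le hnM.le
        ((res_eq_of_agree hν.1 fun _ _ => rfl).symm ▸ hν.1))
    rw [blockStart_eq_of_eq (blockStart_add_one_of_lt hend)
      (fun k hk hkM => (htail k (PNat.add_one_le_iff.1 hk) hkM.le).symm)
      (PNat.add_one_le_iff.2 hnM), htail M hnM le_rfl]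

lemma res_mem_trunc_iff (hE : IsZeckendorf E) (hb : ∀ n, IsMaximal E n (b n)) (M : ℕ+) :
    ∀ ε, res M ε ∈ trunc E M ↔ ∀ k ≤ M, ε k ≤ b (blockStart b ε k) k := by
  induction M using PNat.strongInductionOn with
  | _ M ih =>
  have ih' : ∀ m < M, ∀ ε, res m ε ∈ trunc E m → ε m ≤ b (blockStart b ε m) m :=
    fun m hm ε h => (ih m hm ε).1 h m le_rfl
  refine fun ε => ⟨fun h k hk => ?_, fun h => ?_⟩
  · obtain rfl | hk := hk.eq_or_lt
    · obtain ⟨x, -, -, hx, hle⟩ := hE.exists_max_digit hb ih' h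
      rwa [hx, res_apply_of_le le_rfl,
        blockStart_congr fun j hj => res_apply_of_le hj.le] at hle
    · exact ih' k hk ε (res_mem_trunc_of_le hk.le h)
  · obtain ⟨ρ, hρ, hρε⟩ := exists_mem_trunc_agree ⟨0, hE.zero_mem⟩ fun m hm =>
      (ih m hm ε).2 fun k hk => h k (hk.trans hm.le)
    obtain ⟨z, hz, hzρ, hzM, -⟩ := hE.exists_max_digit hb ih' hρ
    rw [blockStart_congr hρε] at hzM
    obtain ⟨x, hx, hxz, hxM⟩ := hE.exists_digit_eq hb hz ((h M le_rfl).trans_eq hzM.symm)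
    rw [res_eq_of_agree hx fun k hk => ?_]
    · exact hx
    obtain rfl | hk := hk.eq_or_lt
    · exact hxM.symm
    · rw [hxz k hk, hzρ k hk, hρε k hk]

lemma isImmSucc_iff (hE : IsZeckendorf E) (hb : ∀ n, IsMaximal E n (b n)) :
    (res M ε ∈ trunc E M ∧ IsImmSucc (trunc E M) (res M ε) (res M (ε + basis M))) ↔
      (∀ k ≤ M, ε k ≤ b (blockStart b ε k) k) ∧ ε M < b (blockStart b ε M) M := by
  have hstart : ∀ k ≤ M, blockStart b (ε + basis M) k = blockStart b ε k := fun k hk =>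
    blockStart_congr fun j hj => add_basis_apply_of_ne (hj.trans_le hk).ne
  rw [isImmSucc_add_basis_iff, hE.res_mem_trunc_iff hb, hE.res_mem_trunc_iff hb]
  refine and_congr_right fun hadm => ⟨fun h => ?_, fun h k hk => ?_⟩
  · have hM := h M le_rfl
    rwa [hstart M le_rfl, add_basis_apply_self] at hM
  · rw [hstart k hk]
    obtain rfl | hk := hk.eq_or_lt
    · rwa [add_basis_apply_self]
    · rw [add_basis_apply_of_ne hk.ne]
      exact hadm k hk.le

theorem eq_determinedBy (hE : IsZeckendorf E) (hb : ∀ n, IsMaximal E n (b n)) :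
    E = determinedBy b := by
  rw [determinedBy_eq_admissible]
  ext ε
  simp only [hE.mem_iff ε, hE.isImmSucc_iff hb]
  refine ⟨fun h => ⟨fun k => ?_, h.mono fun M hM => hM.2⟩,
    fun h => h.2.mono fun M hM => ⟨fun k _ => h.1 k, hM⟩⟩
  obtain ⟨M, hM, hkM⟩ := h.exists_gt k
  exact hM.1 k hkM.le

end IsZeckendorf

end Zeckendorf

section Expansion

variable {w : ℕ → ℝ}

/-- The remainders of the expansion of `a` in the terms of `w` in which each digit is the largest
one that leaves a positive remainder. -/
noncomputable def ceilRem (w : ℕ → ℝ) (a : ℝ) : ℕ → ℝ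
  | 0 => a
  | j + 1 => ceilRem w a j - (⌈ceilRem w a j / w j⌉₊ - 1 : ℕ) * w j

/-- The digits of the expansion of `a` in the terms of `w` with positive remainders. -/
noncomputable def ceilDigit (w : ℕ → ℝ) (a : ℝ) (j : ℕ) : ℕ := ⌈ceilRem w a j / w j⌉₊ - 1

lemma ceilRem_succ (j : ℕ) : ceilRem w a (j + 1) = ceilRem w a j - ceilDigit w a j * w j := rfl

lemma ceilRem_pos (hw : ∀ j, 0 < w j) (ha : 0 < a) (j : ℕ) : 0 < ceilRem w a j := by
  cases j with
  | zero => exact ha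
  | succ j =>
    have hpos := ceilRem_pos hw ha j
    have hceil := Nat.ceil_pos.2 (div_pos hpos (hw j))
    rw [ceilRem_succ, sub_pos, ← lt_div_iff₀ (hw j), ← Nat.lt_ceil]
    exact Nat.sub_lt hceil one_pos

lemma ceilRem_succ_le (hw : ∀ j, 0 < w j) (j : ℕ) : ceilRem w a (j + 1) ≤ w j := by
  have hceil : ceilRem w a j / w j ≤ ceilDigit w a j + 1 :=
    (Nat.le_ceil _).trans (by exact_mod_cast le_tsub_add)
  rw [div_le_iff₀ (hw j)] at hceil
  rw [ceilRem_succ]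
  linarith

lemma tendsto_ceilRem (hw : ∀ j, 0 < w j) (h0 : Filter.Tendsto w Filter.atTop (nhds 0))
    (ha : 0 < a) : Filter.Tendsto (ceilRem w a) Filter.atTop (nhds 0) :=
  (Filter.tendsto_add_atTop_iff_nat 1).1 <|
    squeeze_zero (fun _ => (ceilRem_pos hw ha _).le) (ceilRem_succ_le hw) h0

lemma sum_range_ceilDigit_mul (m : ℕ) :
    ∑ j ∈ Finset.range m, (ceilDigit w a j : ℝ) * w j = a - ceilRem w a m := by
  induction m with
  | zero => simp [ceilRem]
  | succ m ih => rw [Finset.sum_range_succ, ih, ceilRem_succ]; ring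

theorem hasSum_ceilDigit_mul (hw : ∀ j, 0 < w j) (h0 : Filter.Tendsto w Filter.atTop (nhds 0))
    (ha : 0 < a) : HasSum (fun j => (ceilDigit w a j : ℝ) * w j) a := by
  rw [hasSum_iff_tendsto_nat_of_nonneg fun j => mul_nonneg (Nat.cast_nonneg _) (hw j).le]
  simpa only [sum_range_ceilDigit_mul, sub_zero] using (tendsto_ceilRem hw h0 ha).const_sub a

lemma ceilDigit_zero_ne_zero (hw : 0 < w 0) (ha : w 0 < a) : ceilDigit w a 0 ≠ 0 :=
  (tsub_pos_of_lt (Nat.lt_ceil.2 (by simpa [ceilRem, one_lt_div hw] using ha))).ne'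

lemma infinite_setOf_ceilDigit_ne_zero (hw : ∀ j, 0 < w j)
    (h0 : Filter.Tendsto w Filter.atTop (nhds 0)) (ha : 0 < a) :
    {j | ceilDigit w a j ≠ 0}.Infinite := by
  intro hfin
  obtain ⟨m, hm⟩ := hfin.bddAbove
  have hzero : ∀ j ∉ Finset.range (m + 1), (ceilDigit w a j : ℝ) * w j = 0 := fun j hj => by
    have hdigit : ceilDigit w a j = 0 := by
      by_contra hne
      exact hj (Finset.mem_range_succ_iff.2 (hm hne))
    rw [hdigit, Nat.cast_zero, zero_mul]
  have heq := (hasSum_ceilDigit_mul hw h0 ha).unique (hasSum_sum_of_ne_finset_zero hzero)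
  rw [sum_range_ceilDigit_mul] at heq
  linarith [ceilRem_pos hw ha (m + 1)]

end Expansion

section StartAt

variable {d : ℕ → ℕ}

/-- The positive integer `n + j`. -/
def shift (n : ℕ+) (j : ℕ) : ℕ+ := ⟨n + j, Nat.add_pos_left n.pos j⟩

lemma coe_shift (j : ℕ) : (shift n j : ℕ) = n + j := rfl

lemma shift_injective : Function.Injective (shift n) := fun _ _ h =>
  Nat.add_left_cancel (congrArg PNat.val h)

lemma exists_shift_eq_of_le (h : n ≤ m) : ∃ j, shift n j = m :=
  ⟨m - n, PNat.coe_injective (Nat.add_sub_cancel' h)⟩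

lemma tendsto_shift_atTop : Filter.Tendsto (shift n) Filter.atTop Filter.atTop :=
  Filter.tendsto_atTop.2 fun m => (Filter.eventually_ge_atTop (m : ℕ)).mono fun j hj =>
    PNat.coe_le_coe _ _ |>.1 (hj.trans (Nat.le_add_left j n))

/-- The coefficient function whose coefficients from the index `n` on are the digits `d`. -/
def startAt (n : ℕ+) (d : ℕ → ℕ) : Coeff := fun k => if k < n then 0 else d ((k : ℕ) - n)

lemma startAt_of_lt (h : m < n) : startAt n d m = 0 := if_pos h

lemma startAt_shift (j : ℕ) : startAt n d (shift n j) = d j := by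
  rw [startAt, if_neg (by simp [← PNat.coe_lt_coe, coe_shift]), coe_shift, Nat.add_sub_cancel_left]

lemma hasOrder_startAt (hd : d 0 ≠ 0) : HasOrder (startAt n d) n :=
  ⟨by simpa [startAt] using hd, fun _ hk => not_lt.1 fun hlt => hk (startAt_of_lt hlt)⟩

lemma infSupport_startAt (hd : {j | d j ≠ 0}.Infinite) : InfSupport (startAt n d) :=
  (hd.image shift_injective.injOn).mono <| Set.image_subset_iff.2 fun j hj =>
    (startAt_shift j).trans_ne hj

lemma hasSum_startAt_iff : HasSum (fun k => (startAt n d k : ℝ) * Q k) a ↔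
    HasSum (fun j : ℕ => (d j : ℝ) * Q (shift n j)) a := by
  have hzero : ∀ k ∉ Set.range (shift n), (startAt n d k : ℝ) * Q k = 0 := fun k hk => by
    rw [startAt_of_lt (not_le.1 fun hle => hk (exists_shift_eq_of_le hle)), Nat.cast_zero, zero_mul]
  rw [← shift_injective.hasSum_iff hzero]
  simp only [Function.comp_def, startAt_shift]

end StartAt

theorem exists_fullRecursion (hanti : StrictAnti Q) (hlt : Q 1 < 1)
    (h0 : Filter.Tendsto Q Filter.atTop (nhds 0)) :
    ∃ μ : ℕ+ → Coeff, (∀ n, HasOrder (μ n) n ∧ InfSupport (μ n)) ∧ FullRecursion μ Q := by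
  have hQ : ∀ k, 0 < Q k := fun k =>
    (hanti.antitone.le_of_tendsto h0 (k + 1)).trans_lt (hanti (PNat.lt_add_right k 1))
  have hprev : ∀ n, Q n < prevTerm Q n := fun n => by
    induction n using PNat.recOn with
    | one => rwa [prevTerm_one]
    | succ n => rw [prevTerm_add_one]; exact hanti (PNat.lt_add_right n 1)
  have htail : ∀ n, Filter.Tendsto (fun j => Q (shift n j)) Filter.atTop (nhds 0) := fun n =>
    h0.comp tendsto_shift_atTop
  refine ⟨fun n => startAt n (ceilDigit (fun j => Q (shift n j)) (prevTerm Q n)),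
    fun n => ⟨?_, ?_⟩, fun n => ?_⟩
  · exact hasOrder_startAt (ceilDigit_zero_ne_zero (hQ n) (hprev n))
  · exact infSupport_startAt
      (infinite_setOf_ceilDigit_ne_zero (fun _ => hQ _) (htail n) (prevTerm_pos hQ n))
  · exact hasSum_startAt_iff.2 (hasSum_ceilDigit_mul (fun _ => hQ _) (htail n) (prevTerm_pos hQ n))

section LinearRecursion

variable {N : ℕ} {c p q r : ℕ → ℝ} {ω : ℝ}

/-- Each term of `q` is the combination, with the coefficients `c_0, …, c_{N-1}`, of the `N` terms
that follow it. -/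
def LinearRecursion (N : ℕ) (c q : ℕ → ℝ) : Prop :=
  ∀ n, q n = ∑ j ∈ Finset.range N, c j * q (n + (j + 1))

lemma LinearRecursion.exists_le_succ_add (h : LinearRecursion N p r) (hp : ∀ j, 0 ≤ p j)
    (hsum : ∑ j ∈ Finset.range N, p j = 1) (n : ℕ) : ∃ j < N, r n ≤ r (n + (j + 1)) := by
  obtain ⟨j, hj, hle⟩ := (convexOn_id convex_univ).exists_ge_of_centerMass
    (t := Finset.range N) (w := p) (p := fun j => r (n + (j + 1))) (fun j _ => hp j)
    (hsum.symm ▸ one_pos) fun _ _ => Set.mem_univ _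
  rw [Finset.centerMass_eq_of_sum_1 _ _ hsum] at hle
  exact ⟨j, Finset.mem_range.1 hj, (h n).trans_le hle⟩

lemma LinearRecursion.exists_zero_le_add (h : LinearRecursion N p r) (hp : ∀ j, 0 ≤ p j)
    (hsum : ∑ j ∈ Finset.range N, p j = 1) (n : ℕ) : ∃ j < N, r 0 ≤ r (n + j) := by
  induction n with
  | zero =>
    refine ⟨0, Nat.pos_of_ne_zero ?_, le_rfl⟩
    rintro rfl
    simp at hsum
  | succ n ih =>
    obtain ⟨_ | j, hj, hle⟩ := ih
    · obtain ⟨i, hi, hle'⟩ := h.exists_le_succ_add hp hsum n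
      exact ⟨i, hi, (hle.trans hle').trans_eq (congrArg r (by omega))⟩
    · exact ⟨j, by omega, hle.trans_eq (congrArg r (by omega))⟩

lemma LinearRecursion.pow_mul_le (h : LinearRecursion N p r) (hp : ∀ j, 0 ≤ p j) (hN : 0 < N)
    (hr : ∀ n, 0 ≤ r n) (n j : ℕ) : p 0 ^ j * r (n + j) ≤ r n := by
  induction j with
  | zero => simp
  | succ j ih =>
    have hstep : p 0 * r (n + j + 1) ≤ r (n + j) := by
      rw [h (n + j)]
      exact Finset.single_le_sum (f := fun i => p i * r (n + j + (i + 1)))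
        (fun i _ => mul_nonneg (hp i) (hr _)) (Finset.mem_range.2 hN)
    calc p 0 ^ (j + 1) * r (n + (j + 1)) = p 0 ^ j * (p 0 * r (n + j + 1)) := by ring_nf
      _ ≤ p 0 ^ j * r (n + j) := mul_le_mul_of_nonneg_left hstep (pow_nonneg (hp 0) _)
      _ ≤ r n := ih

-- A Harnack inequality: among any `N` consecutive terms one is at least `r 0`, by the maximum
-- principle, and each step back costs at most a factor `p 0`.
lemma LinearRecursion.pow_mul_zero_le (h : LinearRecursion N p r) (hp : ∀ j, 0 ≤ p j)
    (hsum : ∑ j ∈ Finset.range N, p j = 1) (hr : ∀ n, 0 ≤ r n) (n : ℕ) :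
    p 0 ^ N * r 0 ≤ r n := by
  obtain ⟨j, hj, hle⟩ := h.exists_zero_le_add hp hsum n
  have hN : 0 < N := j.zero_le.trans_lt hj
  have hp1 : p 0 ≤ 1 := hsum ▸
    Finset.single_le_sum (fun j _ => hp j) (Finset.mem_range.2 hN)
  calc p 0 ^ N * r 0 ≤ p 0 ^ j * r (n + j) :=
        mul_le_mul (pow_le_pow_of_le_one (hp 0) hp1 hj.le) hle (hr 0) (pow_nonneg (hp 0) _)
    _ ≤ r n := h.pow_mul_le hp hN hr n j

lemma LinearRecursion.sub_const (h : LinearRecursion N p r)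
    (hsum : ∑ j ∈ Finset.range N, p j = 1) (x : ℝ) : LinearRecursion N p fun n => r n - x :=
  fun n => by
    simp only [mul_sub, Finset.sum_sub_distrib, ← Finset.sum_mul, hsum, one_mul, ← h n]

theorem LinearRecursion.eq_zero_term (h : LinearRecursion N p r) (hp : ∀ j, 0 ≤ p j)
    (hp0 : 0 < p 0) (hsum : ∑ j ∈ Finset.range N, p j = 1) (hr : ∀ n, 0 ≤ r n) (n : ℕ) :
    r n = r 0 := by
  have hN : 0 < N := Nat.pos_of_ne_zero fun hN => by simp [hN] at hsum
  have hbdd : BddBelow (Set.range r) := ⟨0, Set.forall_mem_range.2 hr⟩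
  set x := ⨅ n, r n
  have hrec := h.sub_const hsum x
  have hnonneg : ∀ n, 0 ≤ r n - x := fun n => sub_nonneg.2 (ciInf_le hbdd n)
  have hzero : r 0 = x := by
    have hle : p 0 ^ N * (r 0 - x) + x ≤ x := le_ciInf fun n => by
      linarith [hrec.pow_mul_zero_le hp hsum hnonneg n]
    nlinarith [pow_pos hp0 N, hnonneg 0]
  have hback := hrec.pow_mul_le hp hN hnonneg 0 n
  rw [zero_add, hzero, sub_self] at hback
  linarith [nonpos_of_mul_nonpos_right hback (pow_pos hp0 n), hnonneg n]

theorem LinearRecursion.eq_mul_pow (h : LinearRecursion N c q) (hc : ∀ j, 0 ≤ c j)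
    (hc0 : 0 < c 0) (hω : 0 < ω) (hroot : ∑ j ∈ Finset.range N, c j * ω ^ (j + 1) = 1)
    (hq : ∀ n, 0 ≤ q n) (n : ℕ) : q n = q 0 * ω ^ n := by
  have hrec : LinearRecursion N (fun j => c j * ω ^ (j + 1)) fun n => q n / ω ^ n := fun n => by
    beta_reduce
    rw [h n, Finset.sum_div]
    refine Finset.sum_congr rfl fun j _ => ?_
    rw [pow_add ω n]
    field_simp
  have heq := hrec.eq_zero_term (fun j => mul_nonneg (hc j) (by positivity)) (by positivity) hroot
    (fun n => div_nonneg (hq n) (by positivity)) n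
  rwa [pow_zero, div_one, div_eq_iff (by positivity)] at heq

theorem exists_unique_pos_root (hN : 0 < N) (hc : ∀ j, 0 ≤ c j) (hc0 : 0 < c 0)
    (hsum : 1 < ∑ j ∈ Finset.range N, c j) : ∃ ω ∈ Set.Ioo (0 : ℝ) 1,
      ∀ x, (0 < x ∧ ∑ j ∈ Finset.range N, c j * x ^ (j + 1) = 1) ↔ x = ω := by
  set f : ℝ → ℝ := fun x => ∑ j ∈ Finset.range N, c j * x ^ (j + 1) with hf
  have hf0 : f 0 = 0 := by simp [hf]
  have hf1 : 1 < f 1 := by simpa [hf] using hsum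
  have hmono : StrictMonoOn f (Set.Ici 0) := fun x hx y _ hxy =>
    Finset.sum_lt_sum
      (fun j _ => mul_le_mul_of_nonneg_left (pow_le_pow_left₀ hx hxy.le _) (hc j))
      ⟨0, Finset.mem_range.2 hN, by simpa using mul_lt_mul_of_pos_left hxy hc0⟩
  have hcont : Continuous f := by fun_prop
  obtain ⟨ω, hω, hfω⟩ := intermediate_value_Ioo zero_le_one hcont.continuousOn
    (⟨by rw [hf0]; exact one_pos, hf1⟩ : (1 : ℝ) ∈ Set.Ioo (f 0) (f 1))
  refine ⟨ω, hω, fun x => ⟨fun hx => ?_, fun hx => hx ▸ ⟨hω.1, hfω⟩⟩⟩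
  exact hmono.injOn hx.1.le hω.1.le (hx.2.trans hfω.symm)

end LinearRecursion

section Periodic

variable {N : ℕ} {d q : ℕ → ℝ} {ω : ℝ}

lemma eq_sum_range_add_of_hasSum (hd : Function.Periodic d N) {n : ℕ}
    (h : HasSum (fun j => d j * q (n + (j + 1))) (q n))
    (hN : HasSum (fun j => d j * q (n + N + (j + 1))) (q (n + N))) :
    q n = ∑ j ∈ Finset.range N, d j * q (n + (j + 1)) + q (n + N) := by
  have htail := (hasSum_nat_add_iff' N).2 h
  simp only [hd _, show ∀ j, n + (j + N + 1) = n + N + (j + 1) by omega] at htail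
  linarith [htail.unique hN]

lemma summable_mul_pow_of_periodic (hd : Function.Periodic d N) (hN : N ≠ 0) (hω : |ω| < 1) :
    Summable fun j => d j * ω ^ (j + 1) := by
  have hbound : ∀ j, |d j| ≤ ∑ i ∈ Finset.range N, |d i| := fun j => by
    rw [← hd.map_mod_nat j]
    exact Finset.single_le_sum (f := fun i => |d i|) (fun i _ => abs_nonneg _)
      (Finset.mem_range.2 (j.mod_lt (Nat.pos_of_ne_zero hN)))
  have hgeom : Summable fun j => |ω| ^ (j + 1) :=
    (summable_nat_add_iff 1).2 (summable_geometric_of_lt_one (abs_nonneg ω) hω)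
  refine (hgeom.mul_left (∑ i ∈ Finset.range N, |d i|)).of_norm_bounded fun j => ?_
  rw [Real.norm_eq_abs, abs_mul, abs_pow]
  exact mul_le_mul_of_nonneg_right (hbound j) (by positivity)

lemma hasSum_mul_pow_of_periodic (hd : Function.Periodic d N) (hN : N ≠ 0) (hω : |ω| < 1)
    (hroot : ∑ j ∈ Finset.range N, d j * ω ^ (j + 1) + ω ^ N = 1) :
    HasSum (fun j => d j * ω ^ (j + 1)) 1 := by
  obtain ⟨a, ha⟩ := summable_mul_pow_of_periodic hd hN hω
  have htail := (hasSum_nat_add_iff' N).2 ha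
  have hself : (fun j => d (j + N) * ω ^ (j + N + 1)) = fun j => ω ^ N * (d j * ω ^ (j + 1)) := by
    ext j
    rw [hd]
    ring
  rw [hself] at htail
  have heq := htail.unique (ha.mul_left _)
  have hpow : ω ^ N < 1 := (le_abs_self _).trans_lt <| by
    rw [abs_pow]
    exact pow_lt_one₀ (abs_nonneg ω) hω hN
  have hone : a = 1 := mul_left_cancel₀ (sub_pos.2 hpow).ne' (by linarith)
  rwa [← hone]

end Periodic

section ListMaxima

variable {N : ℕ} {e : ℕ → ℕ} {ω : ℝ}

/-- The digits `e_1, …, e_{N-1}, e_N - 1` repeated with period `N`, indexed from `0`. -/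
def listDigit (N : ℕ) (e : ℕ → ℕ) (j : ℕ) : ℕ :=
  if j % N + 1 = N then e N - 1 else e (j % N + 1)

lemma listMax_eq_startAt : listMax N e n = startAt n (listDigit N e) := rfl

lemma periodic_listDigit : Function.Periodic (fun j => (listDigit N e j : ℝ)) N := fun j => by
  simp only [listDigit, Nat.add_mod_right]

lemma listDigit_zero_ne_zero (hN : 1 ≤ N) (h1 : 0 < e 1) (hL : ¬(N = 1 ∧ e 1 = 1)) :
    listDigit N e 0 ≠ 0 := by
  rw [listDigit, Nat.zero_mod]
  split_ifs with h
  · subst h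
    simp at hL ⊢
    omega
  · exact h1.ne'

lemma infinite_setOf_listDigit_ne_zero (hN : 1 ≤ N) (h0 : listDigit N e 0 ≠ 0) :
    {j | listDigit N e j ≠ 0}.Infinite :=
  Set.infinite_of_forall_exists_gt fun m => ⟨(m + 1) * N,
    by simpa [listDigit] using h0, m.lt_succ_self.trans_le (Nat.le_mul_of_pos_right _ hN)⟩

lemma sum_range_listDigit_mul (hN : 1 ≤ N) (heN : 0 < e N) (x : ℕ → ℝ) :
    ∑ j ∈ Finset.range N, (listDigit N e j : ℝ) * x (j + 1) + x N =
      ∑ j ∈ Finset.range N, (e (j + 1) : ℝ) * x (j + 1) := by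
  obtain ⟨N, rfl⟩ := Nat.exists_eq_add_of_le' hN
  have hinit : ∀ j ∈ Finset.range N, (listDigit (N + 1) e j : ℝ) * x (j + 1) =
      (e (j + 1) : ℝ) * x (j + 1) := fun j hj => by
    have := Finset.mem_range.1 hj
    rw [listDigit, Nat.mod_eq_of_lt (by omega), if_neg (by omega)]
  have hlast : (listDigit (N + 1) e N : ℝ) = e (N + 1) - 1 := by
    rw [listDigit, Nat.mod_eq_of_lt N.lt_succ_self, if_pos rfl, Nat.cast_pred heN]
  rw [Finset.sum_range_succ, Finset.sum_range_succ, Finset.sum_congr rfl hinit, hlast]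
  ring

lemma one_lt_sum_list (hN : 1 ≤ N) (h1 : 0 < e 1) (heN : 0 < e N) (hL : ¬(N = 1 ∧ e 1 = 1)) :
    (1 : ℝ) < ∑ j ∈ Finset.range N, (e (j + 1) : ℝ) := by
  have hsum := sum_range_listDigit_mul hN heN fun _ => 1
  have hpos : (0 : ℝ) < ∑ j ∈ Finset.range N, (listDigit N e j : ℝ) :=
    Finset.sum_pos' (fun _ _ => Nat.cast_nonneg _) ⟨0, Finset.mem_range.2 hN,
      Nat.cast_pos.2 (Nat.pos_of_ne_zero (listDigit_zero_ne_zero hN h1 hL))⟩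
  simp only [mul_one] at hsum
  linarith

lemma fullRecursion_listMax_iff_hasSum : FullRecursion (listMax N e) Q ↔
    ∀ n, HasSum (fun j => (listDigit N e j : ℝ) * withOne Q (n + (j + 1))) (withOne Q n) := by
  have hn : ∀ n : ℕ, HasSum (fun k => (listMax N e n.succPNat k : ℝ) * Q k) (withOne Q n) ↔
      HasSum (fun j => (listDigit N e j : ℝ) * withOne Q (n + (j + 1))) (withOne Q n) := fun n => by
    have hterm : ∀ j, Q (shift n.succPNat j) = withOne Q (n + (j + 1)) := fun j => by
      rw [withOne, dif_pos (by omega)]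
      exact congrArg Q (PNat.coe_injective (by simp [coe_shift]; omega))
    rw [listMax_eq_startAt, hasSum_startAt_iff]
    simp only [hterm]
  refine ⟨fun h n => (hn n).1 (h n.succPNat), fun h n => ?_⟩
  have hsum := (hn n.natPred).2 (h n.natPred)
  rwa [PNat.succPNat_natPred] at hsum

theorem FullRecursion.linearRecursion (h : FullRecursion (listMax N e) Q) (hN : 1 ≤ N)
    (heN : 0 < e N) : LinearRecursion N (fun j => e (j + 1)) (withOne Q) := fun n => by
  have hsum := fullRecursion_listMax_iff_hasSum.1 h
  rw [eq_sum_range_add_of_hasSum periodic_listDigit (hsum n) (hsum (n + N))]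
  exact sum_range_listDigit_mul hN heN fun j => withOne Q (n + j)

theorem fullRecursion_listMax_iff (hN : 1 ≤ N) (h1 : 0 < e 1) (heN : 0 < e N)
    (hω : ω ∈ Set.Ioo (0 : ℝ) 1)
    (hroot : ∑ j ∈ Finset.range N, (e (j + 1) : ℝ) * ω ^ (j + 1) = 1) (hQ : ∀ k, 0 ≤ Q k) :
    FullRecursion (listMax N e) Q ↔ ∀ k : ℕ+, Q k = ω ^ (k : ℕ) := by
  have hcoe : ∀ k : ℕ+, withOne Q k = Q k := fun k => dif_pos k.pos
  refine ⟨fun h k => ?_, fun h => fullRecursion_listMax_iff_hasSum.2 fun n => ?_⟩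
  · have hnonneg : ∀ n, 0 ≤ withOne Q n := fun n => by
      rw [withOne]
      split_ifs
      exacts [hQ _, zero_le_one]
    rw [← hcoe, (h.linearRecursion hN heN).eq_mul_pow (fun _ => Nat.cast_nonneg _)
      (Nat.cast_pos.2 h1) hω.1 hroot hnonneg]
    simp [withOne]
  · have hpow : ∀ n, withOne Q n = ω ^ n := fun n => by
      cases n with
      | zero => simp [withOne]
      | succ n => exact (hcoe n.succPNat).trans (h _)
    have hdigits := (sum_range_listDigit_mul hN heN fun j => ω ^ j).trans hroot
    simpa only [hpow, pow_add _ n, mul_left_comm, mul_one] using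
      (hasSum_mul_pow_of_periodic periodic_listDigit (by omega)
        (abs_lt.2 ⟨by linarith [hω.1], hω.2⟩) hdigits).mul_left (ω ^ n)

theorem strictAnti_and_isFundamental_listMax_iff (hN : 1 ≤ N) (h1 : 0 < e 1) (heN : 0 < e N)
    (hL : ¬(N = 1 ∧ e 1 = 1)) (hω : ω ∈ Set.Ioo (0 : ℝ) 1)
    (hroot : ∑ j ∈ Finset.range N, (e (j + 1) : ℝ) * ω ^ (j + 1) = 1) :
    (StrictAnti Q ∧ IsFundamental (determinedBy (listMax N e)) (Set.Ioo 0 1) Q) ↔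
      ∀ k : ℕ+, Q k = ω ^ (k : ℕ) := by
  have h0 := listDigit_zero_ne_zero hN h1 hL
  have hfund : Antitone Q → (∀ k, 0 < Q k) →
      (IsFundamental (determinedBy (listMax N e)) (Set.Ioo 0 1) Q ↔
        ∀ k : ℕ+, Q k = ω ^ (k : ℕ)) := fun hanti hQ =>
    (isFundamental_determinedBy_iff hanti hQ (fun _ => hasOrder_startAt h0)
      fun _ => infSupport_startAt (infinite_setOf_listDigit_ne_zero hN h0)).trans
      (fullRecursion_listMax_iff hN h1 heN hω hroot fun k => (hQ k).le)
  refine ⟨fun h => (hfund h.1.antitone fun k => (h.2.1 k).1).1 h.2, fun h => ?_⟩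
  have hanti : StrictAnti Q := fun k l hkl => by
    rw [h, h]
    exact pow_lt_pow_right_of_lt_one₀ hω.1 hω.2 hkl
  exact ⟨hanti, (hfund hanti.antitone fun k => h k ▸ pow_pos hω.1 _).2 h⟩

end ListMaxima

end Coeff

theorem mainTheorem6 :
    -- Part 1 (a)
    (∀ Q : ℕ+ → ℝ, StrictAnti Q → (∀ k, Q k ∈ Set.Ioo (0 : ℝ) 1) →
      Filter.Tendsto Q Filter.atTop (nhds 0) →
      ∃ μ : ℕ+ → Coeff, (∀ n, Coeff.HasOrder (μ n) n ∧ Coeff.InfSupport (μ n)) ∧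
        Coeff.FullRecursion μ Q) ∧
    -- Part 1 (b)
    (∀ Q : ℕ+ → ℝ, StrictAnti Q → (∀ k, Q k ∈ Set.Ioo (0 : ℝ) 1) →
      ∀ E : Set Coeff, Coeff.IsZeckendorf E →
      ∀ b : ℕ+ → Coeff, (∀ n, Coeff.IsMaximal E n (b n)) →
        (Coeff.IsFundamental E (Set.Ioo 0 1) Q ↔ Coeff.FullRecursion b Q)) ∧
    -- Part 2
    (∀ (N : ℕ) (e : ℕ → ℕ), 1 ≤ N → 0 < e 1 → 0 < e N → ¬(N = 1 ∧ e 1 = 1) →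
      ∃ ω : ℝ,
        (∀ x : ℝ, (0 < x ∧ ∑ k ∈ Finset.Icc 1 N, (e k : ℝ) * x ^ k - 1 = 0) ↔ x = ω) ∧
        (∃ Q : ℕ+ → ℝ,
          Coeff.IsFundamental (Coeff.determinedBy (Coeff.listMax N e)) (Set.Ioo 0 1) Q) ∧
        ∀ Q : ℕ+ → ℝ,
          (StrictAnti Q ∧
            Coeff.IsFundamental (Coeff.determinedBy (Coeff.listMax N e)) (Set.Ioo 0 1) Q) ↔
          ∀ k : ℕ+, Q k = ω ^ (k : ℕ)) := by
  refine ⟨fun Q hanti hQ h0 => Coeff.exists_fullRecursion hanti (hQ 1).2 h0,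
    fun Q hanti hQ E hE b hb => ?_, fun N e hN h1 heN hL => ?_⟩
  · rw [hE.eq_determinedBy hb]
    exact Coeff.isFundamental_determinedBy_iff hanti.antitone (fun k => (hQ k).1)
      (fun n => (hb n).order) fun n => (hb n).infinite
  · obtain ⟨ω, hω, hroot⟩ := Coeff.exists_unique_pos_root (c := fun j => (e (j + 1) : ℝ)) hN
      (fun _ => Nat.cast_nonneg _) (Nat.cast_pos.2 h1) (Coeff.one_lt_sum_list hN h1 heN hL)
    have hpow := fun Q : ℕ+ → ℝ => Coeff.strictAnti_and_isFundamental_listMax_iff (Q := Q)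
      hN h1 heN hL hω ((hroot ω).2 rfl).2
    refine ⟨ω, fun x => ?_, ⟨fun k => ω ^ (k : ℕ), ((hpow _).2 fun _ => rfl).2⟩, hpow⟩
    rw [← hroot x, sub_eq_zero, Finset.range_eq_Ico,
      Finset.sum_Ico_add' (fun k => (e k : ℝ) * x ^ k) 0 N 1]
    rfl
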